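/- **Theorem (Convergence of NNWR, asymmetric decomposition).** Let $a,b,c,T>0$ with $a\ne b$, and put $\Omega=(-a,b)$, $\Omega_1=(-a,0)$, $\Omega_2=(0,b)$, with outward normals $n_1,n_2$ at the interface $x=0$. Let $f\in L^1(\Omega\times(0,T))$, $u_0,v_0\in L^1(\Omega)$, $g(-a,\cdot),g(b,\cdot)\in L^1(0,T)$, and let $u\in L^1(\Omega\times(0,T))$ be a solution of the wave equation $$\partial_{tt}u-c^2\partial_{xx}u=f \text{ in }\Omega\times(0,T),\quad u(\cdot,0)=u_0,\quad \partial_tu(\cdot,0)=v_0,\quad u=g\text{ on }\partial\Omega\times(0,T).$$ The Neumann–Neumann waveform relaxation (NNWR) algorithm with relaxation parameter $\theta$ starts from an initial guess $w^0\in L^1(0,T)$ and computes, for $n=1,2,\dots$ and $i=1,2$, the solutions $u_i^n,\psi_i^n$ of $$\begin{aligned}&\partial_{tt}u_i^n-c^2\partial_{xx}u_i^n=f\ \text{ in }\Omega_i\times(0,T),\quad u_i^n(\cdot,0)=u_0,\ \ \partial_tu_i^n(\cdot,0)=v_0,\\ &\qquad u_i^n=g \text{ on }\partial\Omega_i\setminus\{0\},\quad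 u_i^n(0,\cdot)=w^{n-1},\\ &\partial_{tt}\psi_i^n-c^2\partial_{xx}\psi_i^n=0\ \text{ in }\Omega_i\times(0,T),\quad \psi_i^n(\cdot,0)=0,\ \ \partial_t\psi_i^n(\cdot,0)=0,\\ &\qquad \psi_i^n=0\text{ on }\partial\Omega_i\setminus\{0\},\quad \partial_{n_i}\psi_i^n=\partial_{n_1}u_1^n+\partial_{n_2}u_2^n\ \text{ at }x=0,\\ &w^n(t)=w^{n-1}(t)-\theta\left[\psi_1^n(0,t)+\psi_2^n(0,t)\right],\qquad t\in(0,T).\end{aligned}$$ Solutions are understood in the weak (transposition) sense: the functions and their Dirichlet boundary values are integrable. For $v\in L^1((l,r)\times(0,T))$ with source $f$, initial data $u_0,v_0$ and boundary values $p_l,p_r$, and for $\varphi\in C^\infty(\mathbb R^2)$ vanishing for $t\ge\tau$ for some $\tau<T$, put $$\mathcal F_v(\varphi)=\int_0^T\!\!\int_l^r\!\big[v(\partial_{tt}\varphi-c^2\partial_{xx}\varphi)-f\varphi\big]dx\,dt+\int_l^r\!\big[u_0\,\partial_t\varphi(\cdot,0)-v_0\,\varphi(\cdot,0)\big]dx+c^2\!\int_0^T\!\big[p_r\,\partial_x\varphi(r,\cdot)-p_l\,\partial_x\varphi(l,\cdot)\big]dt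 .$$ Then $v$ is a solution of the Dirichlet problem if $\mathcal F_v(\varphi)=0$ whenever $\varphi(l,\cdot)=\varphi(r,\cdot)=0$; its normal derivative at an endpoint $y\in\{l,r\}$ is the distribution $q$ if $\mathcal F_v(\varphi)=c^2\langle q,\varphi(y,\cdot)\rangle$ whenever $\varphi$ vanishes at the other endpoint. A function $p\in L^1(0,T)$ is the trace of $u$ at the interface if the restrictions of $u$ to $\Omega_1$ and $\Omega_2$ solve the Dirichlet problems there with the value $p$ at $x=0$. Let $\theta=\frac14$, let $k\ge1$ be an integer and suppose that $$\frac Tk\le 4\min\left\{\frac ac,\frac bc\right\}.$$ Then the NNWR algorithm converges in at most $k+1$ iterations: $u$ has a trace $u(0,\cdot)$ at the interface, and for every run of the algorithm the interface error vanishes after $k$ iterations, $w^n=u(0,\cdot)$ a.e. on $(0,T)$ for all $n\ge k$, and the subdomain solutions are exact from iteration $k+1$ on, $u_i^n=u$ a.e. on $\Omega_i\times(0,T)$ for $i=1,2$ and all $n\ge k+1$. -/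

import Mathlib

open MeasureTheory Set
open scoped ContDiff

namespace NNWR

/-- The wave operator `∂ₜₜ φ - c² ∂ₓₓ φ` at the point `(x, t)`. -/
noncomputable def waveOp (c : ℝ) (φ : ℝ → ℝ → ℝ) (x t : ℝ) : ℝ :=
  iteratedDeriv 2 (fun s => φ x s) t - c ^ 2 * iteratedDeriv 2 (fun y => φ y t) x

/-- Space-time test functions `φ(x, t)`: smooth up to the boundary and vanishing near and after
the final time `T` (no condition at the initial time `0`). -/
def IsTestFunction (T : ℝ) (φ : ℝ → ℝ → ℝ) : Prop :=
  ContDiff ℝ ∞ (fun z : ℝ × ℝ => φ z.1 z.2) ∧ ∃ τ < T, ∀ x t, τ ≤ t → φ x t = 0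

/-- The boundary flux of `u` on the interval `(l, r)`, tested against `φ`, where `u` solves
`∂ₜₜ u - c² ∂ₓₓ u = f`, `u(·, 0) = u₀`, `∂ₜ u(·, 0) = v₀`, with boundary values
`u(l, ·) = pl`, `u(r, ·) = pr` on `(0, T)`.

For a function `u` that is smooth on `[l, r] × [0, T]` and a test function `φ`, Green's formula
says that this number is
`c² ∫₀ᵀ (∂ₙ u(l, t) φ(l, t) + ∂ₙ u(r, t) φ(r, t)) dt`,
with `∂ₙ` the outward normal derivative (`-∂ₓ` at `l`, `∂ₓ` at `r`). -/
noncomputable def fluxPairing (c T l r : ℝ) (f : ℝ → ℝ → ℝ) (u₀ v₀ pl pr : ℝ → ℝ)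
    (u φ : ℝ → ℝ → ℝ) : ℝ :=
  (∫ z in Ioo l r ×ˢ Ioo 0 T, (u z.1 z.2 * waveOp c φ z.1 z.2 - f z.1 z.2 * φ z.1 z.2))
    + (∫ x in Ioo l r, (u₀ x * deriv (fun s => φ x s) 0 - v₀ x * φ x 0))
    + c ^ 2 * ∫ t in Ioo 0 T,
        (pr t * deriv (fun y => φ y t) r - pl t * deriv (fun y => φ y t) l)

/-- The regularity that is asked of a weak solution `u` on `(l, r) × (0, T)` and of its boundary
values: integrability. -/
def IntegrableWithTraces (T l r : ℝ) (pl pr : ℝ → ℝ) (u : ℝ → ℝ → ℝ) : Prop :=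
  IntegrableOn (fun z : ℝ × ℝ => u z.1 z.2) (Ioo l r ×ˢ Ioo 0 T) ∧
    IntegrableOn pl (Ioo 0 T) ∧ IntegrableOn pr (Ioo 0 T)

/-- `u` is a weak solution (in the sense of transposition) on `(l, r) × (0, T)` of
`∂ₜₜ u - c² ∂ₓₓ u = f`, `u(·, 0) = u₀`, `∂ₜ u(·, 0) = v₀`, `u(l, ·) = pl`, `u(r, ·) = pr`:
the equation is multiplied by a test function that vanishes at `x = l` and `x = r`, and all the
derivatives are moved to it. -/
def IsDirichletSolution (c T l r : ℝ) (f : ℝ → ℝ → ℝ) (u₀ v₀ pl pr : ℝ → ℝ)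
    (u : ℝ → ℝ → ℝ) : Prop :=
  IntegrableWithTraces T l r pl pr u ∧
    ∀ φ, IsTestFunction T φ → (∀ t, φ l t = 0) → (∀ t, φ r t = 0) →
      fluxPairing c T l r f u₀ v₀ pl pr u φ = 0

/-- `u` is a weak solution on `(l, r) × (0, T)` with boundary values `pl`, `pr`, and its outward
normal derivative at the **right** end `r` is the distribution `q` in time, given by its action
`q λ = ⟨q, λ⟩` (for an integrable function, `q λ = ∫₀ᵀ q(t) λ(t) dt`). The test functions vanish
at the left end only. -/
def HasRightFlux (c T l r : ℝ) (f : ℝ → ℝ → ℝ) (u₀ v₀ pl pr : ℝ → ℝ)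
    (u : ℝ → ℝ → ℝ) (q : (ℝ → ℝ) → ℝ) : Prop :=
  IntegrableWithTraces T l r pl pr u ∧
    ∀ φ, IsTestFunction T φ → (∀ t, φ l t = 0) →
      fluxPairing c T l r f u₀ v₀ pl pr u φ = c ^ 2 * q (fun t => φ r t)

/-- The same as `HasRightFlux` with the roles of the two ends exchanged: the outward normal
derivative at the **left** end `l` is the distribution `q`. -/
def HasLeftFlux (c T l r : ℝ) (f : ℝ → ℝ → ℝ) (u₀ v₀ pl pr : ℝ → ℝ)
    (u : ℝ → ℝ → ℝ) (q : (ℝ → ℝ) → ℝ) : Prop :=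
  IntegrableWithTraces T l r pl pr u ∧
    ∀ φ, IsTestFunction T φ → (∀ t, φ r t = 0) →
      fluxPairing c T l r f u₀ v₀ pl pr u φ = c ^ 2 * q (fun t => φ l t)

/-- One iteration of the Neumann-Neumann waveform relaxation algorithm on
`Ω = (-a, b)`, `Ω₁ = (-a, 0)`, `Ω₂ = (0, b)`, with relaxation parameter `θ`: from the interface
values `w` (at `x = 0`), solve the Dirichlet problems for `u₁`, `u₂`, then the Neumann problems
for `ψ₁`, `ψ₂`, and update the interface values to `w'`.
* `u₁`, `u₂` have value `g` on the outer boundary and `w` on the interface; `q₁ = ∂ₙ₁ u₁` and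
  `q₂ = ∂ₙ₂ u₂` are their outward normal derivatives on the interface;
* `ψ₁`, `ψ₂` have zero source, zero initial data, zero value on the outer boundary, and outward
  normal derivative `q₁ + q₂` on the interface; `p₁`, `p₂` are their interface values;
* `w' = w - θ (p₁ + p₂)`. -/
def IsStep (a b c T θ : ℝ) (f : ℝ → ℝ → ℝ) (u₀ v₀ : ℝ → ℝ) (g : ℝ → ℝ → ℝ)
    (w : ℝ → ℝ) (u₁ u₂ ψ₁ ψ₂ : ℝ → ℝ → ℝ) (w' : ℝ → ℝ) : Prop :=
  IsDirichletSolution c T (-a) 0 f u₀ v₀ (g (-a)) w u₁ ∧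
  IsDirichletSolution c T 0 b f u₀ v₀ w (g b) u₂ ∧
  ∃ (q₁ q₂ : (ℝ → ℝ) → ℝ) (p₁ p₂ : ℝ → ℝ),
    HasRightFlux c T (-a) 0 f u₀ v₀ (g (-a)) w u₁ q₁ ∧
    HasLeftFlux c T 0 b f u₀ v₀ w (g b) u₂ q₂ ∧
    HasRightFlux c T (-a) 0 0 0 0 0 p₁ ψ₁ (q₁ + q₂) ∧
    HasLeftFlux c T 0 b 0 0 0 p₂ 0 ψ₂ (q₁ + q₂) ∧
    ∀ᵐ t ∂volume.restrict (Ioo 0 T), w' t = w t - θ * (p₁ t + p₂ t)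

/-- The sequences `w n` (`n ≥ 0`) and `u₁ n`, `u₂ n`, `ψ₁ n`, `ψ₂ n` (`n ≥ 1`) are produced by the
Neumann-Neumann waveform relaxation algorithm started from the initial guess `w 0`. -/
def IsRun (a b c T θ : ℝ) (f : ℝ → ℝ → ℝ) (u₀ v₀ : ℝ → ℝ) (g : ℝ → ℝ → ℝ)
    (w : ℕ → ℝ → ℝ) (u₁ u₂ ψ₁ ψ₂ : ℕ → ℝ → ℝ → ℝ) : Prop :=
  ∀ n : ℕ, IsStep a b c T θ f u₀ v₀ g (w n)
    (u₁ (n + 1)) (u₂ (n + 1)) (ψ₁ (n + 1)) (ψ₂ (n + 1)) (w (n + 1))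

/-- `p` is the trace on the interface `{0} × (0, T)` of the weak solution `u` on `Ω = (-a, b)`:
the restrictions of `u` to `Ω₁` and `Ω₂` solve the Dirichlet problems there, with the value `p` on
the interface. -/
def IsInterfaceTrace (a b c T : ℝ) (f : ℝ → ℝ → ℝ) (u₀ v₀ : ℝ → ℝ) (g : ℝ → ℝ → ℝ)
    (u : ℝ → ℝ → ℝ) (p : ℝ → ℝ) : Prop :=
  IsDirichletSolution c T (-a) 0 f u₀ v₀ (g (-a)) p u ∧
    IsDirichletSolution c T 0 b f u₀ v₀ p (g b) u

end NNWR

/-! Everything is done by duality: instead of solving the subdomain problems, one tests them with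
explicit backward waves. Write `A = 2a/c`, `B = 2b/c`, `d = w - p` for the interface error, and `S_σ
η = η(· + σ)`. A wave on the left subdomain with profile `M`, vanishing at `x = -a`, has interface
value `(1 - S_A)M` and slope `-(1/c)(1 + S_A)M'`; on the right the value is `(1 - S_B)M` and the
slope `(1/c)(1 + S_B)M'`. The profiles `(1 - S_B)ν` and `(1 - S_A)ν` give both waves the same
interface value. Since the fluxes of `u` cancel at the interface, testing with them and putting `η =
ν'` gives `∫ p₁ (1 + S_A)(1 - S_B)η = ∫ p₂ (1 - S_A)(1 + S_B)η = ∫ d (2 - 2 S_A S_B)η`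
(`interface_relation`). Making the operators on `p₁` and `p₂` equal and inserting `θ = 1/4` yields
`∫ d' (1 - S_A²)(1 - S_B²)η = -∫ d (S_A - S_B)²η` (`interface_error_step`). The unshifted term has
cancelled, and each remaining shift `2A`, `2B`, `A + B` is at least `4 min(a/c, b/c)`. On positive
times `(1 - S_A²)(1 - S_B²)` is invertible on test functions, so each iteration lengthens by that
amount the initial time interval on which the error vanishes (`error_zone_grows`).

Exactness of the subdomain solutions then follows from uniqueness of weak solutions
(`IsDirichletSolution.unique`), obtained by testing with sine modes times solutions of a forced
oscillator.

The remaining point is that an `L¹` solution has an `L¹` trace (`exists_isInterfaceTrace`). Tested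
on the left subdomain with functions vanishing at both ends, the pairing depends only on the slope
at the interface, by cutting off (`pairing_eq_zero_of_flat`). For a given slope it is half the sum
of the pairings with two localized waves, one on each side. As the wave operator leaves only first
and zeroth derivatives of their profile, the result is an integrable density tested against the
slope. -/

namespace NNWR

/-! ### Calculus of smooth functions of space and time -/

/-- Smoothness of a function of space and time. -/
def SmoothST (φ : ℝ → ℝ → ℝ) : Prop := ContDiff ℝ ∞ (fun z : ℝ × ℝ => φ z.1 z.2)

/-- The space derivative. -/
noncomputable def dX (φ : ℝ → ℝ → ℝ) (x t : ℝ) : ℝ := deriv (fun y => φ y t) x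

/-- The time derivative. -/
noncomputable def dT (φ : ℝ → ℝ → ℝ) (x t : ℝ) : ℝ := deriv (fun s => φ x s) t

namespace SmoothST

variable {φ ψ : ℝ → ℝ → ℝ}

theorem hasDerivAt_dX (h : SmoothST φ) (x t : ℝ) : HasDerivAt (fun y => φ y t) (dX φ x t) x := by
  have h1 : ContDiff ℝ ∞ (fun y : ℝ => φ y t) := by
    have : ContDiff ℝ ∞ (fun y : ℝ => (y, t)) := by fun_prop
    exact ContDiff.comp (g := fun z : ℝ × ℝ => φ z.1 z.2) h this
  exact (h1.differentiable (by simp) x).hasDerivAt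

theorem hasDerivAt_dT (h : SmoothST φ) (x t : ℝ) : HasDerivAt (fun s => φ x s) (dT φ x t) t := by
  have h1 : ContDiff ℝ ∞ (fun s : ℝ => φ x s) := by
    have : ContDiff ℝ ∞ (fun s : ℝ => (x, s)) := by fun_prop
    exact ContDiff.comp (g := fun z : ℝ × ℝ => φ z.1 z.2) h this
  exact (h1.differentiable (by simp) t).hasDerivAt

theorem dX (h : SmoothST φ) : SmoothST (dX φ) := by
  have h1 : (fun z : ℝ × ℝ => NNWR.dX φ z.1 z.2) =
      fun z => fderiv ℝ (fun z : ℝ × ℝ => φ z.1 z.2) z (1, 0) := by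
    ext z
    have hd : HasFDerivAt (fun z : ℝ × ℝ => φ z.1 z.2) _ z :=
      (ContDiff.differentiable h (by simp) z).hasFDerivAt
    have h2 : HasDerivAt (fun y : ℝ => (y, z.2)) ((1 : ℝ), (0 : ℝ)) z.1 :=
      (hasDerivAt_id z.1).prodMk (hasDerivAt_const z.1 z.2)
    exact (HasFDerivAt.comp_hasDerivAt (l := fun z : ℝ × ℝ => φ z.1 z.2) z.1 hd h2).deriv
  unfold SmoothST
  rw [h1]
  exact (ContDiff.fderiv_right (m := ∞) h (by simp)).clm_apply contDiff_const

theorem dT (h : SmoothST φ) : SmoothST (dT φ) := by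
  have h1 : (fun z : ℝ × ℝ => NNWR.dT φ z.1 z.2) =
      fun z => fderiv ℝ (fun z : ℝ × ℝ => φ z.1 z.2) z (0, 1) := by
    ext z
    have hd : HasFDerivAt (fun z : ℝ × ℝ => φ z.1 z.2) _ z :=
      (ContDiff.differentiable h (by simp) z).hasFDerivAt
    have h2 : HasDerivAt (fun s : ℝ => (z.1, s)) ((0 : ℝ), (1 : ℝ)) z.2 :=
      (hasDerivAt_const z.2 z.1).prodMk (hasDerivAt_id z.2)
    exact (HasFDerivAt.comp_hasDerivAt (l := fun z : ℝ × ℝ => φ z.1 z.2) z.2 hd h2).deriv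
  unfold SmoothST
  rw [h1]
  exact (ContDiff.fderiv_right (m := ∞) h (by simp)).clm_apply contDiff_const

theorem continuous (h : SmoothST φ) : Continuous (fun z : ℝ × ℝ => φ z.1 z.2) :=
  ContDiff.continuous h

theorem sub (h : SmoothST φ) (h' : SmoothST ψ) : SmoothST (fun x t => φ x t - ψ x t) :=
  ContDiff.sub h h'

theorem smul_space {χ : ℝ → ℝ} (hχ : ContDiff ℝ ∞ χ) (h : SmoothST φ) :
    SmoothST (fun x t => χ x * φ x t) :=
  ContDiff.mul (hχ.comp contDiff_fst) h

theorem continuous_section_left (h : SmoothST φ) (t : ℝ) : Continuous (fun x => φ x t) :=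
  h.continuous.comp (by fun_prop : Continuous fun x : ℝ => (x, t))

theorem continuous_section_right (h : SmoothST φ) (x : ℝ) : Continuous (fun t => φ x t) :=
  h.continuous.comp (by fun_prop : Continuous fun t : ℝ => (x, t))

end SmoothST

theorem waveOp_eq (c : ℝ) (φ : ℝ → ℝ → ℝ) (x t : ℝ) :
    waveOp c φ x t = dT (dT φ) x t - c ^ 2 * dX (dX φ) x t := by
  simp only [waveOp, iteratedDeriv_succ, iteratedDeriv_zero]
  rfl

theorem SmoothST.continuous_waveOp {φ : ℝ → ℝ → ℝ} (h : SmoothST φ) (c : ℝ) :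
    Continuous (fun z : ℝ × ℝ => waveOp c φ z.1 z.2) := by
  simp only [waveOp_eq]
  exact h.dT.dT.continuous.sub (continuous_const.mul h.dX.dX.continuous)

theorem dX_sub {φ ψ : ℝ → ℝ → ℝ} (h : SmoothST φ) (h' : SmoothST ψ) :
    dX (fun x t => φ x t - ψ x t) = fun x t => dX φ x t - dX ψ x t := by
  ext x t
  exact ((h.hasDerivAt_dX x t).sub (h'.hasDerivAt_dX x t)).deriv

theorem dT_sub {φ ψ : ℝ → ℝ → ℝ} (h : SmoothST φ) (h' : SmoothST ψ) :
    dT (fun x t => φ x t - ψ x t) = fun x t => dT φ x t - dT ψ x t := by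
  ext x t
  exact ((h.hasDerivAt_dT x t).sub (h'.hasDerivAt_dT x t)).deriv

theorem waveOp_sub (c : ℝ) {φ ψ : ℝ → ℝ → ℝ} (h : SmoothST φ) (h' : SmoothST ψ) (x t : ℝ) :
    waveOp c (fun x t => φ x t - ψ x t) x t = waveOp c φ x t - waveOp c ψ x t := by
  simp only [waveOp_eq, dX_sub h h', dT_sub h h', dX_sub h.dX h'.dX, dT_sub h.dT h'.dT]
  ring

/-! ### The flux pairing: locality, linearity, splitting at the interface -/

theorem fluxPairing_eq (c T l r : ℝ) (f : ℝ → ℝ → ℝ) (u₀ v₀ pl pr : ℝ → ℝ) (u φ : ℝ → ℝ → ℝ) :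
    fluxPairing c T l r f u₀ v₀ pl pr u φ =
      (∫ z in Ioo l r ×ˢ Ioo 0 T, (u z.1 z.2 * waveOp c φ z.1 z.2 - f z.1 z.2 * φ z.1 z.2))
      + (∫ x in Ioo l r, (u₀ x * dT φ x 0 - v₀ x * φ x 0))
      + c ^ 2 * ∫ t in Ioo 0 T, (pr t * dX φ r t - pl t * dX φ l t) := rfl

/-- Functions that agree near the closed interval have the same pairing. -/
theorem fluxPairing_congr {c T l r : ℝ} (hlr : l ≤ r) {f : ℝ → ℝ → ℝ} {u₀ v₀ pl pr : ℝ → ℝ}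
    {u φ ψ : ℝ → ℝ → ℝ} {ε : ℝ} (hε : 0 < ε)
    (h : ∀ x ∈ Ioo (l - ε) (r + ε), ∀ t, φ x t = ψ x t) :
    fluxPairing c T l r f u₀ v₀ pl pr u φ = fluxPairing c T l r f u₀ v₀ pl pr u ψ := by
  have hX : ∀ x ∈ Ioo (l - ε) (r + ε), ∀ t, dX φ x t = dX ψ x t := fun x hx t =>
    Filter.EventuallyEq.deriv_eq (by
      filter_upwards [isOpen_Ioo.mem_nhds hx] with y hy using h y hy t)
  have hXX : ∀ x ∈ Ioo (l - ε) (r + ε), ∀ t, dX (dX φ) x t = dX (dX ψ) x t := fun x hx t =>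
    Filter.EventuallyEq.deriv_eq (by
      filter_upwards [isOpen_Ioo.mem_nhds hx] with y hy using hX y hy t)
  have hT : ∀ x ∈ Ioo (l - ε) (r + ε), dT φ x = dT ψ x := fun x hx => by
    have : φ x = ψ x := funext (h x hx)
    ext t; simp only [dT, this]
  have hTT : ∀ x ∈ Ioo (l - ε) (r + ε), ∀ t, dT (dT φ) x t = dT (dT ψ) x t := fun x hx t => by
    change deriv (dT φ x) t = deriv (dT ψ x) t
    rw [hT x hx]
  have hsub : Ioo l r ⊆ Ioo (l - ε) (r + ε) := Ioo_subset_Ioo (by linarith) (by linarith)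
  have hl : l ∈ Ioo (l - ε) (r + ε) := ⟨by linarith, by linarith⟩
  have hr : r ∈ Ioo (l - ε) (r + ε) := ⟨by linarith, by linarith⟩
  rw [fluxPairing_eq, fluxPairing_eq]
  congr 1
  · congr 1
    · refine setIntegral_congr_fun (measurableSet_Ioo.prod measurableSet_Ioo) fun z hz => ?_
      have := hsub hz.1
      simp only [waveOp_eq, hTT _ this, hXX _ this, h _ this]
    · refine setIntegral_congr_fun measurableSet_Ioo fun x hx => ?_
      simp only [hT _ (hsub hx), h _ (hsub hx)]
  · simp only [hX _ hl, hX _ hr]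

/-- Integrability of all the data of the wave equation on `(l, r) × (0, T)`. -/
def IntegrableData (T l r : ℝ) (f : ℝ → ℝ → ℝ) (u₀ v₀ pl pr : ℝ → ℝ) (u : ℝ → ℝ → ℝ) : Prop :=
  IntegrableOn (fun z : ℝ × ℝ => f z.1 z.2) (Ioo l r ×ˢ Ioo 0 T) ∧
    IntegrableOn u₀ (Ioo l r) ∧ IntegrableOn v₀ (Ioo l r) ∧ IntegrableWithTraces T l r pl pr u

theorem integrableOn_mul_continuous_prod {T l r : ℝ} {h ψ : ℝ × ℝ → ℝ}
    (hh : IntegrableOn h (Ioo l r ×ˢ Ioo 0 T)) (hψ : Continuous ψ) :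
    IntegrableOn (fun z => h z * ψ z) (Ioo l r ×ˢ Ioo 0 T) :=
  hh.mul_continuousOn_of_subset hψ.continuousOn (measurableSet_Ioo.prod measurableSet_Ioo)
    (isCompact_Icc.prod isCompact_Icc) (prod_mono Ioo_subset_Icc_self Ioo_subset_Icc_self)

theorem integrableOn_mul_continuous {l r : ℝ} {h ψ : ℝ → ℝ}
    (hh : IntegrableOn h (Ioo l r)) (hψ : Continuous ψ) :
    IntegrableOn (fun z => h z * ψ z) (Ioo l r) :=
  hh.mul_continuousOn_of_subset hψ.continuousOn measurableSet_Ioo isCompact_Icc Ioo_subset_Icc_self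

section

variable {c T l r : ℝ} {f : ℝ → ℝ → ℝ} {u₀ v₀ pl pr : ℝ → ℝ} {u φ ψ : ℝ → ℝ → ℝ}

theorem IntegrableData.integrableOn_interior (h : IntegrableData T l r f u₀ v₀ pl pr u)
    (hφ : SmoothST φ) (c : ℝ) :
    IntegrableOn (fun z : ℝ × ℝ => u z.1 z.2 * waveOp c φ z.1 z.2 - f z.1 z.2 * φ z.1 z.2)
      (Ioo l r ×ˢ Ioo 0 T) :=
  (integrableOn_mul_continuous_prod h.2.2.2.1 (hφ.continuous_waveOp c)).sub
    (integrableOn_mul_continuous_prod h.1 hφ.continuous)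

theorem IntegrableData.integrableOn_initial (h : IntegrableData T l r f u₀ v₀ pl pr u)
    (hφ : SmoothST φ) :
    IntegrableOn (fun x => u₀ x * dT φ x 0 - v₀ x * φ x 0) (Ioo l r) :=
  (integrableOn_mul_continuous h.2.1 (hφ.dT.continuous_section_left 0)).sub
    (integrableOn_mul_continuous h.2.2.1 (hφ.continuous_section_left 0))

theorem IntegrableData.integrableOn_boundary (h : IntegrableData T l r f u₀ v₀ pl pr u)
    (hφ : SmoothST φ) :
    IntegrableOn (fun t => pr t * dX φ r t - pl t * dX φ l t) (Ioo 0 T) :=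
  (integrableOn_mul_continuous h.2.2.2.2.2 (hφ.dX.continuous_section_right r)).sub
    (integrableOn_mul_continuous h.2.2.2.2.1 (hφ.dX.continuous_section_right l))

theorem fluxPairing_sub (h : IntegrableData T l r f u₀ v₀ pl pr u)
    (hφ : SmoothST φ) (hψ : SmoothST ψ) :
    fluxPairing c T l r f u₀ v₀ pl pr u (fun x t => φ x t - ψ x t) =
      fluxPairing c T l r f u₀ v₀ pl pr u φ - fluxPairing c T l r f u₀ v₀ pl pr u ψ := by
  simp only [fluxPairing_eq, dX_sub hφ hψ, dT_sub hφ hψ, waveOp_sub c hφ hψ]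
  have h1 := integral_sub (h.integrableOn_interior hφ c) (h.integrableOn_interior hψ c)
  have h2 := integral_sub (h.integrableOn_initial hφ) (h.integrableOn_initial hψ)
  have h3 := integral_sub (h.integrableOn_boundary hφ) (h.integrableOn_boundary hψ)
  have e : ∀ A B C A' B' C' : ℝ, (A + B + c ^ 2 * C) - (A' + B' + c ^ 2 * C') =
    (A - A') + (B - B') + c ^ 2 * (C - C') := by intros; ring
  rw [e, ← h1, ← h2, ← h3]
  congr 1
  · congr 1
    · congr 1; ext z; ring
    · congr 1; ext z; ring
  · congr 2; ext z; ring

theorem fluxPairing_zero (c T l r : ℝ) (f : ℝ → ℝ → ℝ) (u₀ v₀ pl pr : ℝ → ℝ) (u : ℝ → ℝ → ℝ) :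
    fluxPairing c T l r f u₀ v₀ pl pr u (fun _ _ => 0) = 0 := by
  simp [fluxPairing_eq, waveOp_eq, dX, dT]

theorem IntegrableData.split {p : ℝ → ℝ} {a b : ℝ} (ha : 0 < a) (hb : 0 < b)
    (h : IntegrableData T (-a) b f u₀ v₀ pl pr u) (hp : IntegrableOn p (Ioo 0 T)) :
    IntegrableData T (-a) 0 f u₀ v₀ pl p u ∧ IntegrableData T 0 b f u₀ v₀ p pr u := by
  obtain ⟨h1, h2, h3, h4, h5, h6⟩ := h
  have s1 : Ioo (-a) 0 ⊆ Ioo (-a) b := Ioo_subset_Ioo le_rfl hb.le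
  have s2 : Ioo 0 b ⊆ Ioo (-a) b := Ioo_subset_Ioo (by linarith) le_rfl
  exact ⟨⟨h1.mono_set (prod_mono s1 le_rfl), h2.mono_set s1, h3.mono_set s1,
    h4.mono_set (prod_mono s1 le_rfl), h5, hp⟩,
    ⟨h1.mono_set (prod_mono s2 le_rfl), h2.mono_set s2, h3.mono_set s2,
    h4.mono_set (prod_mono s2 le_rfl), hp, h6⟩⟩

theorem Ioo_ae_eq_union {a b : ℝ} (ha : 0 < a) (hb : 0 < b) :
    (Ioo (-a) b : Set ℝ) =ᵐ[volume] (Ioo (-a) 0 ∪ Ioo 0 b : Set ℝ) := by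
  have h0 : ∀ᵐ x : ℝ, x ≠ 0 := by simp [ae_iff]
  filter_upwards [h0] with x hx
  apply propext
  change (x ∈ Ioo (-a) b) ↔ x ∈ Ioo (-a) 0 ∪ Ioo 0 b
  simp only [mem_Ioo, mem_union]
  constructor
  · rintro ⟨h1, h2⟩
    rcases lt_or_gt_of_ne hx with h | h
    · exact Or.inl ⟨h1, h⟩
    · exact Or.inr ⟨h, h2⟩
  · rintro (⟨h1, h2⟩ | ⟨h1, h2⟩) <;> constructor <;> linarith

theorem integral_Ioo_split {a b : ℝ} (ha : 0 < a) (hb : 0 < b) {h : ℝ → ℝ}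
    (hh : IntegrableOn h (Ioo (-a) b)) :
    ∫ x in Ioo (-a) b, h x = (∫ x in Ioo (-a) 0, h x) + ∫ x in Ioo 0 b, h x := by
  rw [setIntegral_congr_set (Ioo_ae_eq_union ha hb), setIntegral_union
    (Set.disjoint_left.2 fun x hx hx' => by linarith [hx.2, hx'.1]) measurableSet_Ioo
    (hh.mono_set (Ioo_subset_Ioo le_rfl hb.le)) (hh.mono_set (Ioo_subset_Ioo (by linarith) le_rfl))]

theorem integral_Ioo_prod_split {a b : ℝ} (ha : 0 < a) (hb : 0 < b) {h : ℝ × ℝ → ℝ}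
    (hh : IntegrableOn h (Ioo (-a) b ×ˢ Ioo 0 T)) :
    ∫ z in Ioo (-a) b ×ˢ Ioo 0 T, h z =
      (∫ z in Ioo (-a) 0 ×ˢ Ioo 0 T, h z) + ∫ z in Ioo 0 b ×ˢ Ioo 0 T, h z := by
  have e : (Ioo (-a) b ×ˢ Ioo 0 T : Set (ℝ × ℝ)) =ᵐ[volume]
      ((Ioo (-a) 0 ×ˢ Ioo 0 T) ∪ (Ioo 0 b ×ˢ Ioo 0 T) : Set (ℝ × ℝ)) := by
    rw [← union_prod, Measure.volume_eq_prod]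
    exact Measure.set_prod_ae_eq (Ioo_ae_eq_union ha hb) (ae_eq_refl _)
  rw [setIntegral_congr_set e, setIntegral_union
    (Set.disjoint_left.2 fun x hx hx' => by linarith [hx.1.2, hx'.1.1])
    (measurableSet_Ioo.prod measurableSet_Ioo)
    (hh.mono_set (prod_mono (Ioo_subset_Ioo le_rfl hb.le) le_rfl))
    (hh.mono_set (prod_mono (Ioo_subset_Ioo (by linarith) le_rfl) le_rfl))]

/-- The pairing on `(-a, b)` is the sum of the pairings on `(-a, 0)` and `(0, b)`, whatever the
value that is assigned to the interface. -/
theorem fluxPairing_split {a b : ℝ} {p : ℝ → ℝ} (ha : 0 < a) (hb : 0 < b)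
    (h : IntegrableData T (-a) b f u₀ v₀ pl pr u) (hp : IntegrableOn p (Ioo 0 T))
    (hφ : SmoothST φ) :
    fluxPairing c T (-a) b f u₀ v₀ pl pr u φ =
      fluxPairing c T (-a) 0 f u₀ v₀ pl p u φ + fluxPairing c T 0 b f u₀ v₀ p pr u φ := by
  obtain ⟨hd1, hd2⟩ := h.split (p := p) ha hb hp
  simp only [fluxPairing_eq]
  rw [integral_Ioo_prod_split ha hb (h.integrableOn_interior hφ c),
    integral_Ioo_split ha hb (h.integrableOn_initial hφ)]
  have h3 := integral_add (hd1.integrableOn_boundary hφ) (hd2.integrableOn_boundary hφ)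
  have e : ∀ A B C A' B' C' : ℝ, (A + B + c ^ 2 * C) + (A' + B' + c ^ 2 * C') =
    (A + A') + (B + B') + c ^ 2 * (C + C') := by intros; ring
  rw [e, ← h3]
  congr 3; ext t; ring

end

/-! ### Spatial cutoffs and a larger class of test functions -/

/-- Plateau functions on the line. -/
theorem exists_plateau (m : ℝ) {r₁ r₂ : ℝ} (h₁ : 0 < r₁) (h₂ : r₁ < r₂) :
    ∃ χ : ℝ → ℝ, ContDiff ℝ ∞ χ ∧ (∀ x, |x - m| ≤ r₁ → χ x = 1) ∧
      ∀ x, r₂ ≤ |x - m| → χ x = 0 := by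
  let B : ContDiffBump m := ⟨r₁, r₂, h₁, h₂⟩
  exact ⟨B, B.contDiff, fun x hx => B.one_of_mem_closedBall (by simpa [Real.dist_eq] using hx),
    fun x hx => B.zero_of_le_dist (by simpa [Real.dist_eq] using hx)⟩

/-- Smooth functions that vanish near and after time `T`, for `x` in a neighbourhood of
`[l, r]`. -/
def IsTestOn (T l r : ℝ) (φ : ℝ → ℝ → ℝ) : Prop :=
  SmoothST φ ∧ ∃ ε > 0, ∃ τ < T, ∀ x ∈ Ioo (l - ε) (r + ε), ∀ t, τ ≤ t → φ x t = 0

/-- A travelling wave does not vanish after one fixed time for all `x`, so it is no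
`IsTestFunction`; but the pairing sees only a neighbourhood of `[l, r]`, and a plateau in `x`
removes the rest. The factor depends on `x` alone, so every `x` at which `φ` vanishes for all times
is kept, including points outside `[l, r]`. -/
theorem IsTestOn.exists_isTestFunction {T l r : ℝ} (hlr : l ≤ r) {φ : ℝ → ℝ → ℝ}
    (h : IsTestOn T l r φ) :
    ∃ ψ, IsTestFunction T ψ ∧ (∀ x, (∀ t, φ x t = 0) → ∀ t, ψ x t = 0) ∧
      ∃ ε > 0, ∀ x ∈ Ioo (l - ε) (r + ε), ∀ t, ψ x t = φ x t := by
  obtain ⟨hs, ε, hε, τ, hτ, h0⟩ := h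
  obtain ⟨χ, hχ, h1, h2⟩ := exists_plateau ((l + r) / 2) (r₁ := (r - l) / 2 + ε / 2)
    (r₂ := (r - l) / 2 + ε) (by linarith) (by linarith)
  refine ⟨fun x t => χ x * φ x t, ⟨hs.smul_space hχ, τ, hτ, fun x t ht => ?_⟩,
    fun x hx t => by simp [hx t], ε / 2, by linarith, fun x hx t => ?_⟩
  · by_cases hx : x ∈ Ioo (l - ε) (r + ε)
    · simp [h0 x hx t ht]
    · beta_reduce
      rw [h2 x, zero_mul]
      by_contra! hc
      rw [abs_lt] at hc
      exact hx ⟨by linarith [hc.1], by linarith [hc.2]⟩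
  · beta_reduce
    rw [h1 x, one_mul]
    rw [abs_le]
    exact ⟨by linarith [hx.1], by linarith [hx.2]⟩

section

variable {c T l r : ℝ} {f : ℝ → ℝ → ℝ} {u₀ v₀ pl pr : ℝ → ℝ} {u φ ψ : ℝ → ℝ → ℝ}

theorem IsDirichletSolution.pairing_eq_zero (hlr : l ≤ r)
    (h : IsDirichletSolution c T l r f u₀ v₀ pl pr u) (hφ : IsTestOn T l r φ)
    (hl : ∀ t, φ l t = 0) (hr : ∀ t, φ r t = 0) :
    fluxPairing c T l r f u₀ v₀ pl pr u φ = 0 := by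
  obtain ⟨ψ, hψ, -, ε, hε, he⟩ := hφ.exists_isTestFunction hlr
  rw [← fluxPairing_congr hlr hε he]
  exact h.2 ψ hψ (fun t => by rw [he l ⟨by linarith, by linarith⟩, hl])
    (fun t => by rw [he r ⟨by linarith, by linarith⟩, hr])

theorem HasRightFlux.pairing_eq {q : (ℝ → ℝ) → ℝ} (hlr : l ≤ r)
    (h : HasRightFlux c T l r f u₀ v₀ pl pr u q) (hφ : IsTestOn T l r φ)
    (hl : ∀ t, φ l t = 0) :
    fluxPairing c T l r f u₀ v₀ pl pr u φ = c ^ 2 * q (fun t => φ r t) := by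
  obtain ⟨ψ, hψ, -, ε, hε, he⟩ := hφ.exists_isTestFunction hlr
  rw [← fluxPairing_congr hlr hε he,
    h.2 ψ hψ (fun t => by rw [he l ⟨by linarith, by linarith⟩, hl])]
  congr 2; ext t
  exact he r ⟨by linarith, by linarith⟩ t

theorem HasLeftFlux.pairing_eq {q : (ℝ → ℝ) → ℝ} (hlr : l ≤ r)
    (h : HasLeftFlux c T l r f u₀ v₀ pl pr u q) (hφ : IsTestOn T l r φ)
    (hr : ∀ t, φ r t = 0) :
    fluxPairing c T l r f u₀ v₀ pl pr u φ = c ^ 2 * q (fun t => φ l t) := by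
  obtain ⟨ψ, hψ, -, ε, hε, he⟩ := hφ.exists_isTestFunction hlr
  rw [← fluxPairing_congr hlr hε he,
    h.2 ψ hψ (fun t => by rw [he r ⟨by linarith, by linarith⟩, hr])]
  congr 2; ext t
  exact he l ⟨by linarith, by linarith⟩ t

theorem IsTestOn.sub (h : IsTestOn T l r φ) (h' : IsTestOn T l r ψ) :
    IsTestOn T l r (fun x t => φ x t - ψ x t) := by
  obtain ⟨hs, ε, hε, τ, hτ, h0⟩ := h
  obtain ⟨hs', ε', hε', τ', hτ', h0'⟩ := h'
  refine ⟨hs.sub hs', min ε ε', lt_min hε hε', max τ τ', max_lt hτ hτ', fun x hx t ht => ?_⟩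
  beta_reduce
  rw [h0 x ⟨by linarith [hx.1, min_le_left ε ε'], by linarith [hx.2, min_le_left ε ε']⟩ t
      (le_trans (le_max_left _ _) ht),
    h0' x ⟨by linarith [hx.1, min_le_right ε ε'], by linarith [hx.2, min_le_right ε ε']⟩ t
      (le_trans (le_max_right _ _) ht), sub_zero]

end

/-- Smooth functions of time that vanish near and after time `T`. -/
def IsTimeTest (T : ℝ) (μ : ℝ → ℝ) : Prop :=
  ContDiff ℝ ∞ μ ∧ ∃ τ < T, ∀ t, τ ≤ t → μ t = 0

theorem IsTimeTest.isTestOn_mul {T l r : ℝ} {μ χ : ℝ → ℝ} (hμ : IsTimeTest T μ)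
    (hχ : ContDiff ℝ ∞ χ) : IsTestOn T l r (fun x t => χ x * μ t) := by
  obtain ⟨hs, τ, hτ, h0⟩ := hμ
  exact ⟨(hχ.comp contDiff_fst).mul (hs.comp contDiff_snd), 1, one_pos, τ, hτ,
    fun x _ t ht => by simp [h0 t ht]⟩

theorem IsTestOn.isTimeTest {T l r x : ℝ} {φ : ℝ → ℝ → ℝ} (h : IsTestOn T l r φ)
    (hx : x ∈ Icc l r) : IsTimeTest T (φ x) := by
  obtain ⟨hs, ε, hε, τ, hτ, h0⟩ := h
  have : ContDiff ℝ ∞ (fun s : ℝ => (x, s)) := by fun_prop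
  exact ⟨ContDiff.comp (g := fun z : ℝ × ℝ => φ z.1 z.2) hs this, τ, hτ,
    h0 x ⟨by linarith [hx.1], by linarith [hx.2]⟩⟩

/-! ### Cancellation of the exact fluxes at the interface -/

/-- The normal derivatives of the exact solution on the two sides of the interface cancel. -/
theorem IsInterfaceTrace.pairing_add_eq_zero {a b c T : ℝ} (ha : 0 < a) (hb : 0 < b)
    {f : ℝ → ℝ → ℝ} {u₀ v₀ : ℝ → ℝ} {g u : ℝ → ℝ → ℝ} {p : ℝ → ℝ}
    (hd : IntegrableData T (-a) b f u₀ v₀ (g (-a)) (g b) u)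
    (hu : IsDirichletSolution c T (-a) b f u₀ v₀ (g (-a)) (g b) u)
    (hp : IsInterfaceTrace a b c T f u₀ v₀ g u p) {φ₁ φ₂ : ℝ → ℝ → ℝ}
    (h1 : IsTestOn T (-a) 0 φ₁) (h2 : IsTestOn T 0 b φ₂) (h1a : ∀ t, φ₁ (-a) t = 0)
    (h2b : ∀ t, φ₂ b t = 0) (h12 : ∀ t, φ₁ 0 t = φ₂ 0 t) :
    fluxPairing c T (-a) 0 f u₀ v₀ (g (-a)) p u φ₁ +
      fluxPairing c T 0 b f u₀ v₀ p (g b) u φ₂ = 0 := by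
  obtain ⟨χ, hχ, hχ1, hχ0⟩ := exists_plateau 0 (r₁ := min a b / 2) (r₂ := min a b)
    (half_pos (lt_min ha hb)) (half_lt_self (lt_min ha hb))
  have hlam : IsTimeTest T (φ₁ 0) := h1.isTimeTest ⟨by linarith, le_rfl⟩
  -- `φ₁` and `φ₂` need not join smoothly at `0`. Subtracting one smooth function with the same
  -- interface value leaves admissible Dirichlet tests on each side, and `Φ` itself is admissible on
  -- the whole interval.
  set Φ : ℝ → ℝ → ℝ := fun x t => χ x * φ₁ 0 t with hΦ
  have hΦt : ∀ l r, IsTestOn T l r Φ := fun l r => hlam.isTestOn_mul hχ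
  have hχa : χ (-a) = 0 := hχ0 _ (by simp [abs_of_pos ha])
  have hχb : χ b = 0 := hχ0 _ (by simp [abs_of_pos hb])
  have hχ00 : χ 0 = 1 := hχ1 _ (by simp; positivity)
  obtain ⟨hd1, hd2⟩ := hd.split (p := p) ha hb hp.1.1.2.2
  have e1 := hp.1.pairing_eq_zero (by linarith) (h1.sub (hΦt _ _))
    (fun t => by simp [hΦ, hχa, h1a]) (fun t => by simp [hΦ, hχ00])
  have e2 := hp.2.pairing_eq_zero hb.le (h2.sub (hΦt _ _))
    (fun t => by simp [hΦ, hχ00, h12]) (fun t => by simp [hΦ, hχb, h2b])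
  have e3 := hu.pairing_eq_zero (by linarith) (hΦt _ _)
    (fun t => by simp [hΦ, hχa]) (fun t => by simp [hΦ, hχb])
  rw [fluxPairing_sub hd1 h1.1 (hΦt 0 0).1] at e1
  rw [fluxPairing_sub hd2 h2.1 (hΦt 0 0).1] at e2
  rw [fluxPairing_split ha hb hd hp.1.1.2.2 (hΦt 0 0).1] at e3
  linarith

/-! ### Travelling waves and time profiles -/

/-- The travelling wave `μ(t + σ x + k)`. -/
def wave (μ : ℝ → ℝ) (σ k x t : ℝ) : ℝ := μ (t + σ * x + k)

theorem smoothST_wave {μ : ℝ → ℝ} (hμ : ContDiff ℝ ∞ μ) (σ k : ℝ) : SmoothST (wave μ σ k) :=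
  hμ.comp (by fun_prop : ContDiff ℝ ∞ fun z : ℝ × ℝ => z.2 + σ * z.1 + k)

theorem contDiff_deriv {μ : ℝ → ℝ} (hμ : ContDiff ℝ ∞ μ) : ContDiff ℝ ∞ (deriv μ) :=
  (contDiff_infty_iff_deriv.1 hμ).2

theorem hasDerivAt_of_contDiff {μ : ℝ → ℝ} (hμ : ContDiff ℝ ∞ μ) (t : ℝ) :
    HasDerivAt μ (deriv μ t) t :=
  (hμ.differentiable (by simp) t).hasDerivAt

theorem dX_wave {μ : ℝ → ℝ} (hμ : ContDiff ℝ ∞ μ) (σ k : ℝ) :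
    dX (wave μ σ k) = fun x t => σ * wave (deriv μ) σ k x t := by
  ext x t
  have h1 : HasDerivAt (fun y : ℝ => t + σ * y + k) σ x := by
    simpa using (((hasDerivAt_id x).const_mul σ).const_add t).add_const k
  have := (hasDerivAt_of_contDiff hμ (t + σ * x + k)).comp x h1
  rw [mul_comm]
  exact this.deriv

theorem dT_wave {μ : ℝ → ℝ} (hμ : ContDiff ℝ ∞ μ) (σ k : ℝ) :
    dT (wave μ σ k) = wave (deriv μ) σ k := by
  ext x t
  have h1 : HasDerivAt (fun s : ℝ => s + σ * x + k) 1 t := by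
    simpa using ((hasDerivAt_id t).add_const (σ * x)).add_const k
  have := (hasDerivAt_of_contDiff hμ (t + σ * x + k)).comp t h1
  rw [mul_one] at this
  exact this.deriv

theorem waveOp_wave {c σ : ℝ} (hσ : c ^ 2 * σ ^ 2 = 1) {μ : ℝ → ℝ} (hμ : ContDiff ℝ ∞ μ)
    (k x t : ℝ) : waveOp c (wave μ σ k) x t = 0 := by
  have hX : dX (dX (wave μ σ k)) x t = σ ^ 2 * wave (deriv (deriv μ)) σ k x t := by
    have h := (((smoothST_wave (contDiff_deriv hμ) σ k).hasDerivAt_dX x t).const_mul σ).deriv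
    rw [dX_wave (contDiff_deriv hμ)] at h
    rw [dX_wave hμ]
    refine Eq.trans h ?_
    ring
  rw [waveOp_eq, hX, dT_wave hμ, dT_wave (contDiff_deriv hμ)]
  linear_combination -(wave (deriv (deriv μ)) σ k x t) * hσ

/-- A delay that is nonnegative at both ends is nonnegative on `[l, r]`. Outside, within distance
`ε`, it drops below zero by at most `|σ| ε ≤ (T - τ)/2`, which is absorbed by moving the vanishing
time from `τ` to `(T + τ)/2`. -/
theorem IsTimeTest.isTestOn_wave {T l r σ k : ℝ} {μ : ℝ → ℝ} (hμ : IsTimeTest T μ)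
    (hl : 0 ≤ σ * l + k) (hr : 0 ≤ σ * r + k) : IsTestOn T l r (wave μ σ k) := by
  obtain ⟨hs, τ, hτ, h0⟩ := hμ
  have hσ : 0 < |σ| + 1 := by positivity
  refine ⟨smoothST_wave hs σ k, (T - τ) / (2 * (|σ| + 1)), by
    have := sub_pos.2 hτ; positivity, (T + τ) / 2, by linarith, fun x hx t ht => h0 _ ?_⟩
  set ε := (T - τ) / (2 * (|σ| + 1)) with hε
  have hεσ : (|σ| + 1) * ε = (T - τ) / 2 := by rw [hε]; field_simp
  have hε0 : 0 < ε := by rw [hε]; have := sub_pos.2 hτ; positivity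
  have hεσ' : |σ| * ε ≤ (T - τ) / 2 := by nlinarith
  rcases le_total 0 σ with h | h
  · rw [abs_of_nonneg h] at hεσ'
    nlinarith [mul_le_mul_of_nonneg_left hx.1.le h]
  · rw [abs_of_nonpos h] at hεσ'
    nlinarith [mul_le_mul_of_nonpos_left hx.2.le h]

theorem IsTimeTest.shift {T σ : ℝ} {η : ℝ → ℝ} (h : IsTimeTest T η) (hσ : 0 ≤ σ) :
    IsTimeTest T (fun t => η (t + σ)) := by
  obtain ⟨hs, τ, hτ, h0⟩ := h
  exact ⟨hs.comp (by fun_prop), τ, hτ, fun t ht => h0 _ (by linarith)⟩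

theorem IsTimeTest.add {T : ℝ} {η ζ : ℝ → ℝ} (h : IsTimeTest T η) (h' : IsTimeTest T ζ) :
    IsTimeTest T (fun t => η t + ζ t) := by
  obtain ⟨hs, τ, hτ, h0⟩ := h
  obtain ⟨hs', τ', hτ', h0'⟩ := h'
  refine ⟨hs.add hs', max τ τ', max_lt hτ hτ', fun t ht => ?_⟩
  simp [h0 t (le_trans (le_max_left _ _) ht), h0' t (le_trans (le_max_right _ _) ht)]

theorem IsTimeTest.const_mul {T : ℝ} {η : ℝ → ℝ} (h : IsTimeTest T η) (k : ℝ) :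
    IsTimeTest T (fun t => k * η t) := by
  obtain ⟨hs, τ, hτ, h0⟩ := h
  exact ⟨contDiff_const.mul hs, τ, hτ, fun t ht => by simp [h0 t ht]⟩

theorem IsTimeTest.sub {T : ℝ} {η ζ : ℝ → ℝ} (h : IsTimeTest T η) (h' : IsTimeTest T ζ) :
    IsTimeTest T (fun t => η t - ζ t) := by
  simpa [sub_eq_add_neg] using h.add (h'.const_mul (-1))

theorem IsTimeTest.mono {T T' : ℝ} {η : ℝ → ℝ} (h : IsTimeTest T η) (hT : T ≤ T') :
    IsTimeTest T' η := by
  obtain ⟨hs, τ, hτ, h0⟩ := h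
  exact ⟨hs, τ, hτ.trans_le hT, h0⟩

/-- Test functions in time have a primitive that is a test function. -/
theorem IsTimeTest.exists_primitive {T : ℝ} {η : ℝ → ℝ} (h : IsTimeTest T η) :
    ∃ ν, IsTimeTest T ν ∧ deriv ν = η := by
  obtain ⟨hs, τ, hτ, h0⟩ := h
  -- The base point `τ` makes the primitive vanish after `τ`.
  have hd : ∀ t, HasDerivAt (fun t => ∫ s in τ..t, η s) (η t) t := fun t =>
    intervalIntegral.integral_hasDerivAt_right (hs.continuous.intervalIntegrable _ _)
      hs.continuous.stronglyMeasurable.stronglyMeasurableAtFilter hs.continuous.continuousAt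
  have hd' : deriv (fun t => ∫ s in τ..t, η s) = η := funext fun t => (hd t).deriv
  refine ⟨fun t => ∫ s in τ..t, η s, ⟨contDiff_infty_iff_deriv.2
    ⟨fun t => (hd t).differentiableAt, by rwa [hd']⟩, τ, hτ, fun t ht => ?_⟩, hd'⟩
  refine intervalIntegral.integral_zero_ae (Filter.Eventually.of_forall fun s hs => ?_)
  rw [uIoc_of_le ht] at hs
  exact h0 s hs.1.le

section

variable {c T l r : ℝ} {f : ℝ → ℝ → ℝ} {u₀ v₀ pl pr pl' pr' : ℝ → ℝ} {u u' φ : ℝ → ℝ → ℝ}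

/-- The pairing depends linearly on the solution and its boundary values. -/
theorem fluxPairing_sub_data (h : IntegrableData T l r f u₀ v₀ pl pr u)
    (h' : IntegrableData T l r f u₀ v₀ pl' pr' u') (hφ : SmoothST φ) :
    fluxPairing c T l r f u₀ v₀ pl pr u φ - fluxPairing c T l r f u₀ v₀ pl' pr' u' φ =
      (∫ z in Ioo l r ×ˢ Ioo 0 T, (u z.1 z.2 - u' z.1 z.2) * waveOp c φ z.1 z.2) +
      c ^ 2 * ∫ t in Ioo 0 T, ((pr t - pr' t) * dX φ r t - (pl t - pl' t) * dX φ l t) := by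
  have h1 := integral_sub (h.integrableOn_interior hφ c) (h'.integrableOn_interior hφ c)
  have h3 := integral_sub (h.integrableOn_boundary hφ) (h'.integrableOn_boundary hφ)
  have e : ∀ A B C A' C' : ℝ, (A + B + c ^ 2 * C) - (A' + B + c ^ 2 * C') =
    (A - A') + c ^ 2 * (C - C') := by intros; ring
  rw [fluxPairing_eq, fluxPairing_eq, e, ← h1, ← h3]
  congr 1
  · congr 1; ext z; ring
  · congr 2; ext z; ring

theorem fluxPairing_of_waveOp_eq_zero (h0 : ∀ x t, waveOp c φ x t = 0) :
    fluxPairing c T l r 0 0 0 pl pr u φ =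
      c ^ 2 * ∫ t in Ioo 0 T, (pr t * dX φ r t - pl t * dX φ l t) := by
  simp [fluxPairing_eq, h0]

end

/-- The wave that vanishes at `x = -a` and travels to the interface. -/
theorem leftWave_props {a c T : ℝ} (ha : 0 < a) (hc : 0 < c) {μ : ℝ → ℝ} (hμ : IsTimeTest T μ) :
    ∃ φ, IsTestOn T (-a) 0 φ ∧ (∀ t, φ (-a) t = 0) ∧ (∀ t, φ 0 t = μ t - μ (t + 2 * a / c)) ∧
      (∀ x t, waveOp c φ x t = 0) ∧
      ∀ t, dX φ 0 t = -(1 / c) * (deriv μ t + deriv μ (t + 2 * a / c)) := by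
  have hc' : c ≠ 0 := hc.ne'
  have hac : 0 ≤ a / c := by positivity
  have e1 : -(1 / c) * -a + 0 = a / c := by ring
  have e2 : 1 / c * -a + 2 * a / c = a / c := by ring
  have e3 : 0 ≤ 2 * a / c := by positivity
  have t1 : IsTestOn T (-a) 0 (wave μ (-(1 / c)) 0) :=
    hμ.isTestOn_wave (by rw [e1]; exact hac) (by simp)
  have t2 : IsTestOn T (-a) 0 (wave μ (1 / c) (2 * a / c)) :=
    hμ.isTestOn_wave (by rw [e2]; exact hac) (by simpa using e3)
  refine ⟨_, t1.sub t2, fun t => ?_, fun t => ?_, fun x t => ?_, fun t => ?_⟩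
  · simp only [wave]
    rw [add_assoc, add_assoc, e1, e2, sub_self]
  · simp [wave]
  · rw [waveOp_sub c t1.1 t2.1, waveOp_wave (by field_simp) hμ.1, waveOp_wave (by field_simp) hμ.1,
      sub_self]
  · rw [dX_sub t1.1 t2.1, dX_wave hμ.1, dX_wave hμ.1]
    simp only [wave, mul_zero, add_zero]
    ring

/-- The wave that vanishes at `x = b` and travels to the interface. -/
theorem rightWave_props {b c T : ℝ} (hb : 0 < b) (hc : 0 < c) {μ : ℝ → ℝ} (hμ : IsTimeTest T μ) :
    ∃ φ, IsTestOn T 0 b φ ∧ (∀ t, φ b t = 0) ∧ (∀ t, φ 0 t = μ t - μ (t + 2 * b / c)) ∧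
      (∀ x t, waveOp c φ x t = 0) ∧
      ∀ t, dX φ 0 t = (1 / c) * (deriv μ t + deriv μ (t + 2 * b / c)) := by
  have hc' : c ≠ 0 := hc.ne'
  have hac : 0 ≤ b / c := by positivity
  have e1 : 1 / c * b + 0 = b / c := by ring
  have e2 : -(1 / c) * b + 2 * b / c = b / c := by ring
  have e3 : 0 ≤ 2 * b / c := by positivity
  have t1 : IsTestOn T 0 b (wave μ (1 / c) 0) :=
    hμ.isTestOn_wave (by simp) (by rw [e1]; exact hac)
  have t2 : IsTestOn T 0 b (wave μ (-(1 / c)) (2 * b / c)) :=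
    hμ.isTestOn_wave (by simpa using e3) (by rw [e2]; exact hac)
  refine ⟨_, t1.sub t2, fun t => ?_, fun t => ?_, fun x t => ?_, fun t => ?_⟩
  · simp only [wave]
    rw [add_assoc, add_assoc, e1, e2, sub_self]
  · simp [wave]
  · rw [waveOp_sub c t1.1 t2.1, waveOp_wave (by field_simp) hμ.1, waveOp_wave (by field_simp) hμ.1,
      sub_self]
  · rw [dX_sub t1.1 t2.1, dX_wave hμ.1, dX_wave hμ.1]
    simp only [wave, mul_zero, add_zero]
    ring

/-! ### The recursion for the interface error -/

/-- The interface values of the Neumann problems, in terms of the interface error `w - p`, tested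
against time shifts of `η`. -/
theorem interface_relation {a b c T θ : ℝ} (ha : 0 < a) (hb : 0 < b) (hc : 0 < c)
    {f : ℝ → ℝ → ℝ} {u₀ v₀ : ℝ → ℝ} {g u : ℝ → ℝ → ℝ} {p w w' : ℝ → ℝ} {u₁ u₂ ψ₁ ψ₂ : ℝ → ℝ → ℝ}
    (hd : IntegrableData T (-a) b f u₀ v₀ (g (-a)) (g b) u)
    (hu : IsDirichletSolution c T (-a) b f u₀ v₀ (g (-a)) (g b) u)
    (hp : IsInterfaceTrace a b c T f u₀ v₀ g u p)
    (hs : IsStep a b c T θ f u₀ v₀ g w u₁ u₂ ψ₁ ψ₂ w') :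
    ∃ p₁ p₂ : ℝ → ℝ, IntegrableOn p₁ (Ioo 0 T) ∧ IntegrableOn p₂ (Ioo 0 T) ∧
      (∀ᵐ t ∂volume.restrict (Ioo 0 T), w' t = w t - θ * (p₁ t + p₂ t)) ∧
      ∀ η, IsTimeTest T η →
        (∫ t in Ioo 0 T, p₁ t * (η t + η (t + 2 * a / c) - η (t + 2 * b / c)
            - η (t + (2 * a / c + 2 * b / c)))) =
          ∫ t in Ioo 0 T, (w t - p t) * (2 * η t - 2 * η (t + (2 * a / c + 2 * b / c))) ∧
        (∫ t in Ioo 0 T, p₂ t * (η t - η (t + 2 * a / c) + η (t + 2 * b / c)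
            - η (t + (2 * a / c + 2 * b / c)))) =
          ∫ t in Ioo 0 T, (w t - p t) * (2 * η t - 2 * η (t + (2 * a / c + 2 * b / c))) := by
  obtain ⟨hu1, hu2, q₁, q₂, p₁, p₂, hq1, hq2, hψ1, hψ2, hw⟩ := hs
  refine ⟨p₁, p₂, hψ1.1.2.2, hψ2.1.2.1, hw, fun η hη => ?_⟩
  -- Only slopes, hence derivatives of profiles, meet the interface data, so the waves are built
  -- from a primitive of `η`.
  obtain ⟨ν, hν, rfl⟩ := hη.exists_primitive
  set A := 2 * a / c with hA
  set B := 2 * b / c with hB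
  have hA0 : 0 ≤ A := by positivity
  have hB0 : 0 ≤ B := by positivity
  have dν : ∀ σ t, deriv (fun t => ν t - ν (t + σ)) t = deriv ν t - deriv ν (t + σ) := fun σ t =>
    ((hasDerivAt_of_contDiff hν.1 t).sub
      ((hasDerivAt_of_contDiff hν.1 (t + σ)).comp_add_const t σ)).deriv
  -- With the profile shifted by the other subdomain's delay, both waves have the interface value
  -- `(1 - S_A)(1 - S_B)ν`.
  obtain ⟨φ₁, t1, z1, b1, o1, x1⟩ := leftWave_props ha hc (hν.sub (hν.shift hB0))
  obtain ⟨φ₂, t2, z2, b2, o2, x2⟩ := rightWave_props hb hc (hν.sub (hν.shift hA0))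
  simp only [dν, ← hA, ← hB] at x1 x2 b1 b2
  have h12 : (fun t => φ₁ 0 t) = fun t => φ₂ 0 t := by
    ext t
    rw [b1, b2, add_right_comm]
    ring
  have hg := hp.pairing_add_eq_zero ha hb hd hu t1 t2 z1 z2 (fun t => congrFun h12 t)
  obtain ⟨hd1, hd2⟩ := hd.split (p := p) ha hb hp.1.1.2.2
  have hd1' : IntegrableData T (-a) 0 f u₀ v₀ (g (-a)) w u₁ := ⟨hd1.1, hd1.2.1, hd1.2.2.1, hu1.1⟩
  have hd2' : IntegrableData T 0 b f u₀ v₀ w (g b) u₂ := ⟨hd2.1, hd2.2.1, hd2.2.2.1, hu2.1⟩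
  have e1 := hq1.pairing_eq (by linarith) t1 z1
  have e2 := hq2.pairing_eq hb.le t2 z2
  have e3 := hψ1.pairing_eq (by linarith) t1 z1
  have e4 := hψ2.pairing_eq hb.le t2 z2
  have d1 := fluxPairing_sub_data (c := c) hd1' hd1 t1.1
  have d2 := fluxPairing_sub_data (c := c) hd2' hd2 t2.1
  rw [fluxPairing_of_waveOp_eq_zero o1] at e3
  rw [fluxPairing_of_waveOp_eq_zero o2] at e4
  rw [← h12] at e2 e4
  simp only [o1, o2, mul_zero, integral_zero, zero_add, sub_self, zero_mul, sub_zero, zero_sub,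
    Pi.zero_apply, Pi.add_apply, x1, x2] at d1 d2 e3 e4
  have hwp : IntegrableOn (fun t => w t - p t) (Ioo 0 T) := hu1.1.2.2.sub hp.1.1.2.2
  have hη' : Continuous (deriv ν) := hη.1.continuous
  have kd := integral_add (integrableOn_mul_continuous hwp (by fun_prop :
      Continuous fun t => -(1 / c) * (deriv ν t - deriv ν (t + B) +
        (deriv ν (t + A) - deriv ν (t + A + B)))))
    (integrableOn_mul_continuous hwp (by fun_prop :
      Continuous fun t => 1 / c * (deriv ν t - deriv ν (t + A) +
        (deriv ν (t + B) - deriv ν (t + B + A))))).neg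
  -- The two slopes add up through `(1 + S_A)(1 - S_B) + (1 - S_A)(1 + S_B) = 2 - 2 S_A S_B`.
  have k0 : (∫ t in Ioo 0 T, (w t - p t) * (2 * deriv ν t - 2 * deriv ν (t + (A + B)))) =
      -(c * (q₁ (fun t => φ₁ 0 t) + q₂ (fun t => φ₁ 0 t))) := by
    refine mul_left_cancel₀ hc.ne' ?_
    have h1 : c ^ 2 * q₁ (fun t => φ₁ 0 t) + c ^ 2 * q₂ (fun t => φ₁ 0 t) = _ + _ :=
      (by linarith : _ = _ + _).trans (congrArg₂ (· + ·) d1 d2)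
    rw [mul_neg, ← mul_assoc, ← pow_two, mul_add, h1, ← mul_add]
    simp only [Pi.neg_apply] at kd
    rw [← kd, pow_two, mul_assoc, ← mul_neg]
    congr 1
    rw [← neg_mul, ← integral_const_mul]
    congr 1; ext t
    rw [add_assoc t B A, add_comm B A, add_assoc t A B]
    field_simp
    ring
  have k1 : (∫ t in Ioo 0 T, p₁ t * (deriv ν t + deriv ν (t + A) - deriv ν (t + B)
      - deriv ν (t + (A + B)))) = -(c * (q₁ (fun t => φ₁ 0 t) + q₂ (fun t => φ₁ 0 t))) := by
    refine mul_left_cancel₀ hc.ne' ?_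
    rw [mul_neg, ← mul_assoc, ← pow_two, ← e3, pow_two, mul_assoc, ← mul_neg]
    congr 1
    rw [← neg_mul, ← integral_const_mul]
    congr 1; ext t
    rw [add_assoc t A B]
    field_simp
    ring
  have k2 : (∫ t in Ioo 0 T, p₂ t * (deriv ν t - deriv ν (t + A) + deriv ν (t + B)
      - deriv ν (t + (A + B)))) = -(c * (q₁ (fun t => φ₁ 0 t) + q₂ (fun t => φ₁ 0 t))) := by
    refine mul_left_cancel₀ hc.ne' ?_
    rw [mul_neg, ← mul_assoc, ← pow_two, ← e4, pow_two, mul_assoc, ← mul_neg]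
    congr 1
    rw [← neg_mul, ← integral_const_mul]
    congr 1; ext t
    rw [add_assoc t B A, add_comm B A]
    field_simp
    ring
  exact ⟨k1.trans k0.symm, k2.trans k0.symm⟩

/-- The interface error after one step, tested against time shifts of `η`. -/
theorem interface_error_step {a b c T : ℝ} (ha : 0 < a) (hb : 0 < b) (hc : 0 < c)
    {f : ℝ → ℝ → ℝ} {u₀ v₀ : ℝ → ℝ} {g u : ℝ → ℝ → ℝ} {p w w' : ℝ → ℝ} {u₁ u₂ ψ₁ ψ₂ : ℝ → ℝ → ℝ}
    (hd : IntegrableData T (-a) b f u₀ v₀ (g (-a)) (g b) u)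
    (hu : IsDirichletSolution c T (-a) b f u₀ v₀ (g (-a)) (g b) u)
    (hp : IsInterfaceTrace a b c T f u₀ v₀ g u p)
    (hs : IsStep a b c T (1 / 4) f u₀ v₀ g w u₁ u₂ ψ₁ ψ₂ w') :
    IntegrableOn w' (Ioo 0 T) ∧ ∀ η, IsTimeTest T η →
      (∫ t in Ioo 0 T, (w' t - p t) * (η t - η (t + 4 * a / c) - (η (t + 4 * b / c)
          - η (t + 4 * b / c + 4 * a / c)))) =
        ∫ t in Ioo 0 T, (w t - p t) * (2 * η (t + (2 * a / c + 2 * b / c)) - η (t + 4 * a / c)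
          - η (t + 4 * b / c)) := by
  obtain ⟨p₁, p₂, hp1, hp2, hw, hr⟩ := interface_relation ha hb hc hd hu hp hs
  have hwi : IntegrableOn w (Ioo 0 T) := hs.1.1.2.2
  have hpi : IntegrableOn p (Ioo 0 T) := hp.1.1.2.2
  refine ⟨(hwi.sub ((hp1.add hp2).const_mul (1 / 4))).congr
    (by filter_upwards [hw] with t ht using ht.symm), fun η hη => ?_⟩
  set A := 2 * a / c with hA
  set B := 2 * b / c with hB
  have eA : 4 * a / c = A + A := by rw [hA]; ring
  have eB : 4 * b / c = B + B := by rw [hB]; ring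
  have hA0 : 0 ≤ A := by positivity
  have hB0 : 0 ≤ B := by positivity
  have hηc : Continuous η := hη.1.continuous
  rw [eA, eB]
  -- The relations for `p₁` and `p₂` are used with `(1 - S_A)(1 + S_B)η` and `(1 + S_A)(1 - S_B)η`:
  -- on the left both then carry `(1 - S_A²)(1 - S_B²)η`, and on the right the sum is `(2 - 2 S_A
  -- S_B)²η`.
  have s1 := (hr _ (((hη.sub (hη.shift hA0)).add (hη.shift hB0)).sub
    (hη.shift (add_nonneg hA0 hB0)))).1
  have s2 := (hr _ (((hη.add (hη.shift hA0)).sub (hη.shift hB0)).sub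
    (hη.shift (add_nonneg hA0 hB0)))).2
  have hX : Continuous fun t => η t - η (t + (A + A)) - (η (t + (B + B))
    - η (t + (B + B) + (A + A))) := by fun_prop
  have hwp : IntegrableOn (fun t => w t - p t) (Ioo 0 T) := hwi.sub hpi
  have s3 : (∫ t in Ioo 0 T, p₁ t * (η t - η (t + (A + A)) - (η (t + (B + B))
      - η (t + (B + B) + (A + A))))) + (∫ t in Ioo 0 T, p₂ t * (η t - η (t + (A + A)) -
      (η (t + (B + B)) - η (t + (B + B) + (A + A))))) = ∫ t in Ioo 0 T, (w t - p t) *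
        (4 * η t - 8 * η (t + (A + B)) + 4 * η (t + (B + B) + (A + A))) := by
    refine Eq.trans (congrArg₂ (· + ·) (Eq.trans ?_ s1) (Eq.trans ?_ s2)) ?_
    · congr 1; ext t; ring_nf
    · congr 1; ext t; ring_nf
    · refine (integral_add (integrableOn_mul_continuous hwp (by fun_prop))
        (integrableOn_mul_continuous hwp (by fun_prop))).symm.trans ?_
      congr 1; ext t; ring_nf
  have s4 : (∫ t in Ioo 0 T, (w' t - p t) * (η t - η (t + (A + A)) - (η (t + (B + B))
      - η (t + (B + B) + (A + A))))) = (∫ t in Ioo 0 T, (w t - p t) * (η t - η (t + (A + A)) -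
      (η (t + (B + B)) - η (t + (B + B) + (A + A))))) - (1 / 4) * ((∫ t in Ioo 0 T, p₁ t *
      (η t - η (t + (A + A)) - (η (t + (B + B)) - η (t + (B + B) + (A + A))))) +
      (∫ t in Ioo 0 T, p₂ t * (η t - η (t + (A + A)) -
      (η (t + (B + B)) - η (t + (B + B) + (A + A)))))) := by
    have j1 := integrableOn_mul_continuous hp1 hX
    have j2 := integrableOn_mul_continuous hp2 hX
    have j3 : IntegrableOn (fun t => (1 / 4) * (p₁ t * (η t - η (t + (A + A)) - (η (t + (B + B))
        - η (t + (B + B) + (A + A)))) + p₂ t * (η t - η (t + (A + A)) - (η (t + (B + B))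
        - η (t + (B + B) + (A + A)))))) (Ioo 0 T) := (j1.add j2).const_mul _
    rw [← integral_add j1 j2, ← integral_const_mul,
      ← integral_sub (integrableOn_mul_continuous hwp hX) j3]
    refine integral_congr_ae ?_
    filter_upwards [hw] with t ht
    rw [ht]
    ring
  -- With the factor `1/4`, `(1 - S_A²)(1 - S_B²) - (1 - S_A S_B)² = 2 S_A S_B - S_A² - S_B²`,
  -- without an unshifted term.
  rw [s4, s3, ← integral_const_mul, ← integral_sub (integrableOn_mul_continuous hwp hX)
    ((integrableOn_mul_continuous hwp (by fun_prop)).const_mul _)]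
  congr 1; ext t; ring_nf

/-! ### Propagation of the zero zone by duality -/

/-- On `[0, ∞)`, a test function in time is the difference of another one and its shift. -/
theorem IsTimeTest.exists_sub_shift {T σ : ℝ} (hσ : 0 < σ) {η : ℝ → ℝ} (h : IsTimeTest T η) :
    ∃ ζ, IsTimeTest T ζ ∧ ∀ t, 0 ≤ t → ζ t - ζ (t + σ) = η t := by
  obtain ⟨N, hN⟩ := exists_nat_gt (T / σ)
  rw [div_lt_iff₀ hσ] at hN
  -- The finite geometric sum `ζ = η + S_σ η + ...` telescopes; after `N` terms the leftover `η(t +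
  -- Nσ)` vanishes for `t ≥ 0`, because `Nσ > T`.
  have key : ∀ n : ℕ, ∃ ζ, IsTimeTest T ζ ∧ ∀ t, ζ t - ζ (t + σ) = η t - η (t + n * σ) := by
    intro n
    induction n with
    | zero => exact ⟨fun t => 0 * η t, h.const_mul 0, fun t => by simp⟩
    | succ n ih =>
      obtain ⟨ζ, hζ, e⟩ := ih
      refine ⟨_, hζ.add (h.shift (σ := n * σ) (by positivity)), fun t => ?_⟩
      have := e t
      have e2 : t + σ + n * σ = t + ((n + 1 : ℕ) : ℝ) * σ := by push_cast; ring
      rw [e2]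
      linarith
  obtain ⟨ζ, hζ, e⟩ := key N
  refine ⟨ζ, hζ, fun t ht => ?_⟩
  obtain ⟨-, τ, hτ, h0⟩ := h
  rw [e t, h0 (t + N * σ) (by linarith), sub_zero]

/-- An integrable function that annihilates all test functions in time is zero. -/
theorem ae_eq_zero_of_forall_isTimeTest {S : ℝ} {h : ℝ → ℝ} (hh : IntegrableOn h (Ioo 0 S))
    (h0 : ∀ η, IsTimeTest S η → ∫ t in Ioo 0 S, h t * η t = 0) :
    ∀ᵐ t ∂volume.restrict (Ioo 0 S), h t = 0 := by
  rw [ae_restrict_iff' measurableSet_Ioo]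
  refine isOpen_Ioo.ae_eq_zero_of_integral_contDiff_smul_eq_zero
    (hh.locallyIntegrableOn) fun η hη hηc hηs => ?_
  have htest : IsTimeTest S η := by
    refine ⟨hη, ?_⟩
    rcases (tsupport η).eq_empty_or_nonempty with he | hne
    · refine ⟨S - 1, by linarith, fun t _ => ?_⟩
      exact image_eq_zero_of_notMem_tsupport (by simp [he])
    · obtain ⟨m, hm, hmax⟩ := hηc.isCompact.exists_isGreatest hne
      have := (hηs hm).2
      refine ⟨(m + S) / 2, by linarith, fun t ht => ?_⟩
      refine image_eq_zero_of_notMem_tsupport fun hmem => ?_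
      linarith [hmax hmem]
  have e := h0 η htest
  rw [← e, ← integral_indicator measurableSet_Ioo]
  congr 1; ext t
  by_cases ht : t ∈ Ioo 0 S
  · simp [ht, mul_comm]
  · rw [indicator_of_notMem ht, image_eq_zero_of_notMem_tsupport (fun hm => ht (hηs hm)), zero_smul]

/-- The zone in which the error vanishes grows with every step. -/
theorem error_zone_grows {T s m α β γ : ℝ} {d d' : ℝ → ℝ} (hd' : IntegrableOn d' (Ioo 0 T))
    (hα : 0 < α) (hβ : 0 < β) (hmα : m ≤ α) (hmβ : m ≤ β) (hmγ : m ≤ γ)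
    (hrec : ∀ η, IsTimeTest T η →
      (∫ t in Ioo 0 T, d' t * (η t - η (t + α) - (η (t + β) - η (t + β + α)))) =
        ∫ t in Ioo 0 T, d t * (2 * η (t + γ) - η (t + α) - η (t + β)))
    (h0 : ∀ᵐ t ∂volume.restrict (Ioo 0 T), t < s → d t = 0) :
    ∀ᵐ t ∂volume.restrict (Ioo 0 T), t < s + m → d' t = 0 := by
  set S := min T (s + m) with hS
  have hsub : Ioo 0 S ⊆ Ioo 0 T := Ioo_subset_Ioo le_rfl (min_le_left _ _)
  have key : ∀ᵐ t ∂volume.restrict (Ioo 0 S), d' t = 0 := by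
    refine ae_eq_zero_of_forall_isTimeTest (hd'.mono_set hsub) fun η hη => ?_
    -- Inverting `1 - S_α` and `1 - S_β` on positive times turns `∫ d' η` into the left side of the
    -- recursion. The inverses use forward shifts only, so `ξ` still vanishes after `S`.
    obtain ⟨ζ, hζ, e1⟩ := hη.exists_sub_shift hα
    obtain ⟨ξ, hξ, e2⟩ := hζ.exists_sub_shift hβ
    have hS0 : ∀ t, S ≤ t → ξ t = 0 := by
      obtain ⟨-, τ, hτ, h⟩ := hξ
      exact fun t ht => h t (hτ.le.trans ht)
    have e := hrec ξ (hξ.mono (min_le_left _ _))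
    -- Before `s` the factor `d` vanishes; from `s` on, each shifted argument is at least `s + m ≥
    -- S`, where `ξ` vanishes.
    have hz : (∫ t in Ioo 0 T, d t * (2 * ξ (t + γ) - ξ (t + α) - ξ (t + β))) = 0 := by
      refine integral_eq_zero_of_ae ?_
      filter_upwards [h0] with t ht
      by_cases hts : t < s
      · simp [ht hts]
      · have : S ≤ s + m := min_le_right _ _
        rw [hS0 (t + γ) (by linarith), hS0 (t + α) (by linarith), hS0 (t + β) (by linarith)]
        simp
    rw [hz] at e
    refine Eq.trans ?_ ((setIntegral_eq_of_subset_of_forall_sdiff_eq_zero measurableSet_Ioo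
      hsub ?_).symm.trans e)
    · refine setIntegral_congr_fun measurableSet_Ioo fun t ht => ?_
      rw [← e1 t ht.1.le, ← e2 t ht.1.le, ← e2 (t + α) (by linarith [ht.1]), add_right_comm t β α]
      ring
    · intro t ht
      have : S ≤ t := by
        by_contra! hc
        exact ht.2 ⟨ht.1.1, hc⟩
      rw [hS0 t this, hS0 _ (by linarith), hS0 _ (by linarith), hS0 _ (by linarith)]
      simp
  rw [ae_restrict_iff' measurableSet_Ioo] at key ⊢
  filter_upwards [key] with t ht hT hm
  exact ht ⟨hT.1, lt_min hT.2 hm⟩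

/-- After `n` steps the interface error vanishes up to the time `4 n min(a/c, b/c)`. -/
theorem interface_error_zone {a b c T : ℝ} (ha : 0 < a) (hb : 0 < b) (hc : 0 < c)
    {f : ℝ → ℝ → ℝ} {u₀ v₀ : ℝ → ℝ} {g u : ℝ → ℝ → ℝ} {p : ℝ → ℝ} {w : ℕ → ℝ → ℝ}
    {u₁ u₂ ψ₁ ψ₂ : ℕ → ℝ → ℝ → ℝ}
    (hd : IntegrableData T (-a) b f u₀ v₀ (g (-a)) (g b) u)
    (hu : IsDirichletSolution c T (-a) b f u₀ v₀ (g (-a)) (g b) u)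
    (hp : IsInterfaceTrace a b c T f u₀ v₀ g u p)
    (hrun : IsRun a b c T (1 / 4) f u₀ v₀ g w u₁ u₂ ψ₁ ψ₂) (n : ℕ) :
    ∀ᵐ t ∂volume.restrict (Ioo 0 T), t < n * (4 * min (a / c) (b / c)) → w n t - p t = 0 := by
  induction n with
  | zero =>
    rw [ae_restrict_iff' measurableSet_Ioo]
    refine Filter.Eventually.of_forall fun t ht h => ?_
    simp only [CharP.cast_eq_zero, zero_mul] at h
    exact absurd ht.1 (not_lt.2 h.le)
  | succ n ih =>
    obtain ⟨hw', hrec⟩ := interface_error_step ha hb hc hd hu hp (hrun n)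
    have h1 := min_le_left (a / c) (b / c)
    have h2 := min_le_right (a / c) (b / c)
    have := error_zone_grows (hw'.sub hp.1.1.2.2) (by positivity) (by positivity)
      (by linarith [mul_div_assoc 4 a c] : 4 * min (a / c) (b / c) ≤ 4 * a / c)
      (by linarith [mul_div_assoc 4 b c] : 4 * min (a / c) (b / c) ≤ 4 * b / c)
      (by linarith [mul_div_assoc 2 a c, mul_div_assoc 2 b c]) hrec ih
    filter_upwards [this] with t ht h
    exact ht (by push_cast at h; linarith)

/-! ### Completeness of sines and uniqueness of weak solutions -/

/-- Each factor `cos θ` is removed by `sin((m+1)θ) cos θ = ½ (sin((m+2)θ) + sin(mθ))`. Quantifying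
over all frequencies lets the induction on the power close. -/
theorem integral_sin_mul_cos_pow_eq_zero {l r : ℝ} {h θ : ℝ → ℝ} (hθ : Continuous θ)
    (hh : IntegrableOn h (Ioo l r))
    (h0 : ∀ n : ℕ, ∫ x in Ioo l r, h x * Real.sin (n * θ x) = 0) (k : ℕ) :
    ∀ n : ℕ, ∫ x in Ioo l r, h x * (Real.sin (n * θ x) * Real.cos (θ x) ^ k) = 0 := by
  induction k with
  | zero => simpa using h0
  | succ k ih =>
    rintro (_ | m)
    · simp
    · have h1 := integral_add
        (integrableOn_mul_continuous hh (by fun_prop :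
          Continuous fun x => Real.sin ((m + 2 : ℕ) * θ x) * Real.cos (θ x) ^ k))
        (integrableOn_mul_continuous hh (by fun_prop :
          Continuous fun x => Real.sin (m * θ x) * Real.cos (θ x) ^ k))
      rw [ih, ih, add_zero] at h1
      have h2 : (1 / 2 : ℝ) * (∫ x in Ioo l r, (h x * (Real.sin ((m + 2 : ℕ) * θ x) *
          Real.cos (θ x) ^ k) + h x * (Real.sin (m * θ x) * Real.cos (θ x) ^ k))) = 0 := by
        rw [h1, mul_zero]
      rw [← integral_const_mul] at h2
      rw [← h2]
      congr 1; ext x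
      have e1 : ((m + 2 : ℕ) : ℝ) * θ x = (m + 1 : ℕ) * θ x + θ x := by push_cast; ring
      have e2 : (m : ℝ) * θ x = (m + 1 : ℕ) * θ x - θ x := by push_cast; ring
      rw [e1, e2, Real.sin_add, Real.sin_sub, pow_succ]
      ring

/-- The sine functions are complete in `L¹(l, r)`. -/
theorem ae_eq_zero_of_sine_coefficients {l r : ℝ} (hlr : l < r) {h : ℝ → ℝ}
    (hh : IntegrableOn h (Ioo l r))
    (h0 : ∀ n : ℕ, ∫ x in Ioo l r, h x * Real.sin (n * (Real.pi / (r - l) * (x - l))) = 0) :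
    ∀ᵐ x ∂volume.restrict (Ioo l r), h x = 0 := by
  set θ : ℝ → ℝ := fun x => Real.pi / (r - l) * (x - l) with hθ
  have hθc : Continuous θ := by fun_prop
  have hL : 0 < r - l := sub_pos.2 hlr
  have hθm : ∀ x ∈ Ioo l r, θ x ∈ Ioo 0 Real.pi := fun x hx => by
    have h1 : 0 < x - l := sub_pos.2 hx.1
    refine ⟨by have := Real.pi_pos; simp only [hθ]; positivity, ?_⟩
    simp only [hθ]
    rw [div_mul_eq_mul_div, div_lt_iff₀ hL]
    exact mul_lt_mul_of_pos_left (by linarith [hx.2]) Real.pi_pos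
  have hF : IntegrableOn (fun x => h x * Real.sin (θ x)) (Ioo l r) :=
    integrableOn_mul_continuous hh (by fun_prop)
  have hpoly : ∀ P : Polynomial ℝ,
      ∫ x in Ioo l r, h x * Real.sin (θ x) * P.eval (Real.cos (θ x)) = 0 := by
    intro P
    induction P using Polynomial.induction_on' with
    | add P Q hP hQ =>
      simp only [Polynomial.eval_add, mul_add]
      rw [integral_add (integrableOn_mul_continuous hF (by fun_prop))
        (integrableOn_mul_continuous hF (by fun_prop)), hP, hQ, add_zero]
    | monomial k s =>
      have := integral_sin_mul_cos_pow_eq_zero hθc hh h0 k 1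
      have e := congrArg (s * ·) this
      simp only [mul_zero, ← integral_const_mul] at e
      rw [← e]
      congr 1; ext x
      simp only [Polynomial.eval_monomial, Nat.cast_one, one_mul]
      ring
  have hFz : ∀ᵐ x, x ∈ Ioo l r → h x * Real.sin (θ x) = 0 := by
    refine isOpen_Ioo.ae_eq_zero_of_integral_contDiff_smul_eq_zero
      hF.locallyIntegrableOn fun ζ hζ hζc hζs => ?_
    have e0 : ∫ x, ζ x • (h x * Real.sin (θ x)) = ∫ x in Ioo l r, h x * Real.sin (θ x) * ζ x := by
      rw [← integral_indicator measurableSet_Ioo]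
      congr 1; ext x
      by_cases hx : x ∈ Ioo l r
      · simp [hx, mul_comm]
      · rw [indicator_of_notMem hx, image_eq_zero_of_notMem_tsupport (fun hm => hx (hζs hm)),
          zero_smul]
    rw [e0]
    set M := ∫ x in Ioo l r, ‖h x * Real.sin (θ x)‖ with hM
    have hM0 : 0 ≤ M := integral_nonneg fun _ => norm_nonneg _
    have hbound : ∀ ε > 0, ‖∫ x in Ioo l r, h x * Real.sin (θ x) * ζ x‖ ≤ M * ε := by
      intro ε hε
      -- As `cos ∘ θ` is injective on the interval, `ζ` is a continuous function of `cos (θ x)`, and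
      -- Weierstrass approximation makes it uniformly close to a polynomial in `cos (θ x)`.
      obtain ⟨P, hP⟩ := exists_polynomial_near_of_continuousOn (-1) 1
        (fun y => ζ (l + (r - l) / Real.pi * Real.arccos y))
        (hζ.continuous.comp (continuous_const.add
          (continuous_const.mul Real.continuous_arccos))).continuousOn ε hε
      have e1 : ∫ x in Ioo l r, h x * Real.sin (θ x) * ζ x =
          ∫ x in Ioo l r, h x * Real.sin (θ x) * (ζ x - P.eval (Real.cos (θ x))) := by
        simp only [mul_sub]
        rw [integral_sub (integrableOn_mul_continuous hF hζ.continuous)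
          (integrableOn_mul_continuous hF (by fun_prop)), hpoly, sub_zero]
      rw [e1, hM, ← integral_mul_const]
      refine norm_integral_le_of_norm_le (hF.norm.mul_const ε) ?_
      rw [ae_restrict_iff' measurableSet_Ioo]
      refine Filter.Eventually.of_forall fun x hx => ?_
      rw [norm_mul]
      refine mul_le_mul_of_nonneg_left ?_ (norm_nonneg _)
      have h1 := hP (Real.cos (θ x)) ⟨Real.neg_one_le_cos _, Real.cos_le_one _⟩
      have h2 : l + (r - l) / Real.pi * θ x = x := by
        have := Real.pi_ne_zero
        have := hL.ne'
        simp only [hθ]; field_simp; ring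
      rw [Real.arccos_cos (hθm x hx).1.le (hθm x hx).2.le, h2] at h1
      rw [Real.norm_eq_abs, abs_sub_comm]
      exact h1.le
    have hle : ‖∫ x in Ioo l r, h x * Real.sin (θ x) * ζ x‖ ≤ 0 := by
      refine le_of_forall_pos_le_add fun δ hδ => ?_
      -- `M + 1` covers the case `M = 0`.
      refine (hbound (δ / (M + 1)) (by positivity)).trans ?_
      rw [zero_add, mul_div_assoc', div_le_iff₀ (by positivity)]
      nlinarith
    exact norm_le_zero_iff.1 hle
  rw [ae_restrict_iff' measurableSet_Ioo]
  filter_upwards [hFz] with x hx hm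
  exact (mul_eq_zero.1 (hx hm)).resolve_right
    (Real.sin_pos_of_pos_of_lt_pi (hθm x hm).1 (hθm x hm).2).ne'

/-- Backward solution of the forced harmonic oscillator. -/
theorem IsTimeTest.exists_oscillator {T om : ℝ} (hom : om ≠ 0) {γ : ℝ → ℝ} (hγ : IsTimeTest T γ) :
    ∃ β, IsTimeTest T β ∧ ∀ t, deriv (deriv β) t + om ^ 2 * β t = γ t := by
  have mulT : ∀ {s η : ℝ → ℝ}, ContDiff ℝ ∞ s → IsTimeTest T η →
      IsTimeTest T (fun t => s t * η t) := by
    rintro s η hs ⟨h, τ, hτ, h0⟩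
    exact ⟨hs.mul h, τ, hτ, fun t ht => by simp [h0 t ht]⟩
  have hsin : ContDiff ℝ ∞ fun t => Real.sin (om * t) := by fun_prop
  have hcos : ContDiff ℝ ∞ fun t => Real.cos (om * t) := by fun_prop
  obtain ⟨P, hP, dP⟩ := (mulT hsin hγ).exists_primitive
  obtain ⟨Q, hQ, dQ⟩ := (mulT hcos hγ).exists_primitive
  have d1 : ∀ t, HasDerivAt (fun t => Real.sin (om * t)) (Real.cos (om * t) * om) t := fun t => by
    simpa using ((hasDerivAt_id t).const_mul om).sin
  have d2 : ∀ t, HasDerivAt (fun t => Real.cos (om * t)) (-Real.sin (om * t) * om) t := fun t => by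
    simpa using ((hasDerivAt_id t).const_mul om).cos
  have d3 : ∀ t, HasDerivAt P (Real.sin (om * t) * γ t) t := fun t => by
    have := hasDerivAt_of_contDiff hP.1 t; rwa [dP] at this
  have d4 : ∀ t, HasDerivAt Q (Real.cos (om * t) * γ t) t := fun t => by
    have := hasDerivAt_of_contDiff hQ.1 t; rwa [dQ] at this
  -- Variation of constants; the primitives `P`, `Q` vanish at late times, so the solution does too.
  refine ⟨_, ((mulT hsin hQ).sub (mulT hcos hP)).const_mul om⁻¹, fun t => ?_⟩
  have e1 : deriv (fun t => om⁻¹ * (Real.sin (om * t) * Q t - Real.cos (om * t) * P t)) =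
      fun t => Real.cos (om * t) * Q t + Real.sin (om * t) * P t := by
    ext t
    refine ((((d1 t).mul (d4 t)).sub ((d2 t).mul (d3 t))).const_mul om⁻¹).deriv.trans ?_
    field_simp
    ring
  have e2 : deriv (fun t => Real.cos (om * t) * Q t + Real.sin (om * t) * P t) t = _ :=
    (((d2 t).mul (d4 t)).add ((d1 t).mul (d3 t))).deriv
  rw [e1, e2]
  field_simp
  linear_combination γ t * Real.sin_sq_add_cos_sq (om * t)

/-- Weak solutions of the Dirichlet problem are unique. -/
theorem IsDirichletSolution.unique {c T l r : ℝ} (hc : 0 < c) (hlr : l < r)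
    {f : ℝ → ℝ → ℝ} {u₀ v₀ pl pr pl' pr' : ℝ → ℝ} {u u' : ℝ → ℝ → ℝ}
    (hd : IntegrableData T l r f u₀ v₀ pl pr u)
    (h : IsDirichletSolution c T l r f u₀ v₀ pl pr u)
    (h' : IsDirichletSolution c T l r f u₀ v₀ pl' pr' u')
    (hl : ∀ᵐ t ∂volume.restrict (Ioo 0 T), pl t = pl' t)
    (hr : ∀ᵐ t ∂volume.restrict (Ioo 0 T), pr t = pr' t) :
    ∀ᵐ z : ℝ × ℝ ∂volume.restrict (Ioo l r ×ˢ Ioo 0 T), u z.1 z.2 = u' z.1 z.2 := by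
  have hd' : IntegrableData T l r f u₀ v₀ pl' pr' u' := ⟨hd.1, hd.2.1, hd.2.2.1, h'.1⟩
  set I := volume.restrict (Ioo l r) with hI
  set J := volume.restrict (Ioo 0 T) with hJ
  have hIJ : (volume : Measure (ℝ × ℝ)).restrict (Ioo l r ×ˢ Ioo 0 T) = I.prod J := by
    rw [hI, hJ, Measure.prod_restrict, Measure.volume_eq_prod]
  set e : ℝ × ℝ → ℝ := fun z => u z.1 z.2 - u' z.1 z.2 with he
  have hei : IntegrableOn e (Ioo l r ×ˢ Ioo 0 T) := h.1.1.sub h'.1.1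
  have hei' : Integrable e (I.prod J) := by rw [← hIJ]; exact hei
  have hL : 0 < r - l := sub_pos.2 hlr
  set k := Real.pi / (r - l) with hk
  have hk0 : 0 < k := div_pos Real.pi_pos hL
  have hkL : k * (r - l) = Real.pi := div_mul_cancel₀ _ hL.ne'
  have key : ∀ (n : ℕ) γ, IsTimeTest T γ →
      ∫ z in Ioo l r ×ˢ Ioo 0 T, e z * (Real.sin (n * (k * (z.1 - l))) * γ z.2) = 0 := by
    intro n γ hγ
    rcases Nat.eq_zero_or_pos n with rfl | hn
    · simp
    have hn' : (0 : ℝ) < n := Nat.cast_pos.2 hn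
    -- At the frequency `c n k` of the `n`-th mode, the wave operator maps `sin(n k (x - l)) β` to
    -- `sin(n k (x - l)) γ`.
    obtain ⟨β, hβ, hode⟩ := hγ.exists_oscillator (om := c * (n * k)) (by positivity)
    have hsin : ContDiff ℝ ∞ fun x => Real.sin (n * (k * (x - l))) := by fun_prop
    have ht : IsTestOn T l r (fun x t => Real.sin (n * (k * (x - l))) * β t) :=
      hβ.isTestOn_mul hsin
    have z1 : ∀ t, (fun x t => Real.sin (n * (k * (x - l))) * β t) l t = 0 := by simp
    have z2 : ∀ t, (fun x t => Real.sin (n * (k * (x - l))) * β t) r t = 0 := by simp [hkL]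
    have hs := fluxPairing_sub_data (c := c) hd hd' ht.1
    rw [h.pairing_eq_zero hlr.le ht z1 z2, h'.pairing_eq_zero hlr.le ht z1 z2] at hs
    have hb : (∫ t in Ioo 0 T, ((pr t - pr' t) *
        dX (fun x t => Real.sin (n * (k * (x - l))) * β t) r t - (pl t - pl' t) *
        dX (fun x t => Real.sin (n * (k * (x - l))) * β t) l t)) = 0 := by
      refine integral_eq_zero_of_ae ?_
      filter_upwards [hl, hr] with t h1 h2
      simp [h1, h2]
    rw [hb, mul_zero, add_zero, sub_self] at hs
    refine Eq.trans ?_ hs.symm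
    congr 1; ext ⟨x, t⟩
    simp only [he]
    congr 1
    have g1 : ∀ y : ℝ, HasDerivAt (fun y => (n : ℝ) * (k * (y - l))) (n * k) y := fun y => by
      simpa using (((hasDerivAt_id y).sub_const l).const_mul k).const_mul (n : ℝ)
    have g2 : dX (dX (fun x t => Real.sin (n * (k * (x - l))) * β t)) x t =
        -(Real.sin (n * (k * (x - l))) * (n * k)) * (n * k) * β t := by
      have : dX (fun x t => Real.sin (n * (k * (x - l))) * β t) =
          fun x t => Real.cos (n * (k * (x - l))) * (n * k) * β t := by
        ext y s
        exact ((g1 y).sin.mul_const (β s)).deriv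
      rw [this]
      refine (((g1 x).cos.mul_const (n * k)).mul_const (β t)).deriv.trans ?_
      ring
    have g3 : dT (dT (fun x t => Real.sin (n * (k * (x - l))) * β t)) x t =
        Real.sin (n * (k * (x - l))) * deriv (deriv β) t := by
      have : dT (fun x t => Real.sin (n * (k * (x - l))) * β t) =
          fun x t => Real.sin (n * (k * (x - l))) * deriv β t := by
        ext y s
        exact ((hasDerivAt_of_contDiff hβ.1 s).const_mul _).deriv
      rw [this]
      exact ((hasDerivAt_of_contDiff (contDiff_deriv hβ.1) t).const_mul _).deriv
    rw [waveOp_eq, g2, g3, ← hode t]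
    ring
  have hn : ∀ n : ℕ, ∀ᵐ t ∂J, ∫ x in Ioo l r, e (x, t) * Real.sin (n * (k * (x - l))) = 0 := by
    intro n
    have hint : Integrable (fun z : ℝ × ℝ => e z * Real.sin (n * (k * (z.1 - l)))) (I.prod J) := by
      rw [← hIJ]
      exact integrableOn_mul_continuous_prod hei (by fun_prop)
    refine ae_eq_zero_of_forall_isTimeTest hint.integral_prod_right fun γ hγ => ?_
    have hint2 : Integrable (fun z : ℝ × ℝ =>
        e z * (Real.sin (n * (k * (z.1 - l))) * γ z.2)) (I.prod J) := by
      rw [← hIJ]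
      have := hγ.1.continuous
      exact integrableOn_mul_continuous_prod hei (by fun_prop)
    have hkey := key n γ hγ
    rw [hIJ, integral_prod_symm _ hint2] at hkey
    refine Eq.trans ?_ hkey
    congr 1; ext t
    rw [← integral_mul_const]
    congr 1; ext x
    ring
  have hslice : ∀ᵐ t ∂J, ∀ᵐ x ∂I, e (x, t) = 0 := by
    filter_upwards [ae_all_iff.2 hn, hei'.prod_left_ae] with t ht hti
    exact ae_eq_zero_of_sine_coefficients hlr hti ht
  -- Passing through the `L¹` norm converts vanishing on almost every time slice into vanishing
  -- almost everywhere on the product.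
  have hnorm : ∫ z, ‖e z‖ ∂(I.prod J) = 0 := by
    rw [integral_prod_symm _ hei'.norm]
    refine integral_eq_zero_of_ae ?_
    filter_upwards [hslice] with t ht
    refine integral_eq_zero_of_ae ?_
    filter_upwards [ht] with x hx
    simp [hx]
  rw [integral_eq_zero_iff_of_nonneg (fun _ => norm_nonneg _) hei'.norm] at hnorm
  rw [hIJ]
  filter_upwards [hnorm] with z hz
  exact sub_eq_zero.1 (norm_eq_zero.1 hz)

/-! ### Cutting off at the interface -/

theorem dX_smul_space {χ : ℝ → ℝ} (hχ : ContDiff ℝ ∞ χ) {φ : ℝ → ℝ → ℝ} (h : SmoothST φ) :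
    dX (fun x t => χ x * φ x t) = fun x t => deriv χ x * φ x t + χ x * dX φ x t := by
  ext x t
  exact ((hasDerivAt_of_contDiff hχ x).mul (h.hasDerivAt_dX x t)).deriv

theorem dT_smul_space (χ : ℝ → ℝ) {φ : ℝ → ℝ → ℝ} (h : SmoothST φ) :
    dT (fun x t => χ x * φ x t) = fun x t => χ x * dT φ x t := by
  ext x t
  exact ((h.hasDerivAt_dT x t).const_mul (χ x)).deriv

theorem waveOp_smul_space (c : ℝ) {χ : ℝ → ℝ} (hχ : ContDiff ℝ ∞ χ) {φ : ℝ → ℝ → ℝ}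
    (h : SmoothST φ) (x t : ℝ) :
    waveOp c (fun x t => χ x * φ x t) x t = χ x * waveOp c φ x t -
      c ^ 2 * (2 * (deriv χ x * dX φ x t) + deriv (deriv χ) x * φ x t) := by
  have h1 : dX (fun x t => deriv χ x * φ x t + χ x * dX φ x t) x t =
      (deriv (deriv χ) x * φ x t + deriv χ x * dX φ x t) +
        (deriv χ x * dX φ x t + χ x * dX (dX φ) x t) :=
    (((hasDerivAt_of_contDiff (contDiff_deriv hχ) x).mul (h.hasDerivAt_dX x t)).add
      ((hasDerivAt_of_contDiff hχ x).mul (h.dX.hasDerivAt_dX x t))).deriv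
  rw [waveOp_eq, waveOp_eq, dX_smul_space hχ h, dT_smul_space χ h, dT_smul_space χ h.dT, h1]
  ring

/-- A smooth step with the scale invariant bounds that are used to cut off near the interface. -/
theorem exists_smooth_step : ∃ (θ : ℝ → ℝ) (K : ℝ), ContDiff ℝ ∞ θ ∧ (∀ y ≤ -1, θ y = 1) ∧
    (∀ y, -1 / 2 ≤ y → θ y = 0) ∧ (∀ y < -1, deriv θ y = 0) ∧ (∀ y < -1, deriv (deriv θ) y = 0) ∧
    (∀ y, |θ y| ≤ 1) ∧ (∀ y ≤ 0, |y * deriv θ y| ≤ K) ∧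
    ∀ y ≤ 0, |y ^ 2 * deriv (deriv θ) y| ≤ K := by
  -- The affine argument sends `-1` to `1` and `-1/2` to `0`.
  set θ : ℝ → ℝ := fun y => Real.smoothTransition (-2 * y - 1) with hθ
  have hs : ContDiff ℝ ∞ θ := Real.smoothTransition.contDiff.comp (by fun_prop)
  have h1 : ∀ y ≤ -1, θ y = 1 := fun y hy => Real.smoothTransition.one_of_one_le (by linarith)
  have hd : ∀ y < -1, deriv θ y = 0 := fun y hy => by
    have : θ =ᶠ[nhds y] fun _ => 1 := by
      filter_upwards [isOpen_Iio.mem_nhds hy] with x hx using h1 x (le_of_lt hx)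
    rw [this.deriv_eq, deriv_const]
  have hdd : ∀ y < -1, deriv (deriv θ) y = 0 := fun y hy => by
    have : deriv θ =ᶠ[nhds y] fun _ => 0 := by
      filter_upwards [isOpen_Iio.mem_nhds hy] with x hx using hd x hx
    rw [this.deriv_eq, deriv_const]
  have c1 : Continuous (deriv θ) := (contDiff_deriv hs).continuous
  have c2 : Continuous (deriv (deriv θ)) := (contDiff_deriv (contDiff_deriv hs)).continuous
  obtain ⟨K₁, hK₁⟩ := isCompact_Icc.exists_bound_of_continuousOn (s := Icc (-1 : ℝ) 0)
    (f := fun y => y * deriv θ y) (by fun_prop)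
  obtain ⟨K₂, hK₂⟩ := isCompact_Icc.exists_bound_of_continuousOn (s := Icc (-1 : ℝ) 0)
    (f := fun y => y ^ 2 * deriv (deriv θ) y) (by fun_prop)
  have hK0 : 0 ≤ K₁ := (norm_nonneg _).trans (hK₁ 0 (by simp))
  refine ⟨θ, max K₁ K₂, hs, h1, fun y hy => Real.smoothTransition.zero_of_nonpos (by linarith),
    hd, hdd, fun y => ?_, fun y hy => ?_, fun y hy => ?_⟩
  · rw [abs_of_nonneg (Real.smoothTransition.nonneg _)]
    exact Real.smoothTransition.le_one _
  · rcases lt_or_ge y (-1) with h | h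
    · rw [hd y h, mul_zero, abs_zero]; exact hK0.trans (le_max_left _ _)
    · exact (hK₁ y ⟨h, hy⟩).trans (le_max_left _ _)
  · rcases lt_or_ge y (-1) with h | h
    · rw [hdd y h, mul_zero, abs_zero]; exact hK0.trans (le_max_left _ _)
    · exact (hK₂ y ⟨h, hy⟩).trans (le_max_right _ _)

theorem exists_bound_on_rectangle {φ : ℝ → ℝ → ℝ} (h : Continuous (fun z : ℝ × ℝ => φ z.1 z.2))
    (l r T : ℝ) : ∃ C, ∀ x ∈ Icc l r, ∀ t ∈ Icc 0 T, |φ x t| ≤ C := by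
  obtain ⟨C, hC⟩ := (isCompact_Icc.prod isCompact_Icc).exists_bound_of_continuousOn
    (s := Icc l r ×ˢ Icc 0 T) h.continuousOn
  exact ⟨C, fun x hx t ht => hC (x, t) ⟨hx, ht⟩⟩

/-- A function that vanishes at `0` is bounded by its derivative times the distance to `0`. -/
theorem abs_le_mul_of_deriv_le {h : ℝ → ℝ} (hh : Differentiable ℝ h) (h0 : h 0 = 0) {x C : ℝ}
    (hC : ∀ y ∈ Icc x 0, |deriv h y| ≤ C) (hx : x ≤ 0) : |h x| ≤ C * |x| := by
  have := (convex_Icc x 0).norm_image_sub_le_of_norm_deriv_le (f := h) (C := C)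
    (fun y _ => hh y) hC (right_mem_Icc.2 hx) (left_mem_Icc.2 hx)
  simpa [h0] using this

/-- Integrating a bound on the second space derivative from `0`, once and twice. These orders
compensate the factors `n` and `n²` from differentiating `θ(n x)`. -/
theorem flat_bounds {φ : ℝ → ℝ → ℝ} (hφ : SmoothST φ) {a T : ℝ} (h0 : ∀ t, φ 0 t = 0)
    (h1 : ∀ t, dX φ 0 t = 0) :
    ∃ M, ∀ x ∈ Icc (-a) 0, ∀ t ∈ Icc 0 T, |dX φ x t| ≤ M * |x| ∧ |φ x t| ≤ M * x ^ 2 := by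
  obtain ⟨M, hM⟩ := exists_bound_on_rectangle hφ.dX.dX.continuous (-a) 0 T
  have hA : ∀ x ∈ Icc (-a) 0, ∀ t ∈ Icc 0 T, |dX φ x t| ≤ M * |x| := fun x hx t ht =>
    abs_le_mul_of_deriv_le (h := fun y => dX φ y t)
      (fun y => (hφ.dX.hasDerivAt_dX y t).differentiableAt) (h1 t)
      (fun y hy => hM y ⟨hx.1.trans hy.1, hy.2⟩ t ht) hx.2
  refine ⟨M, fun x hx t ht => ⟨hA x hx t ht, ?_⟩⟩
  have hM0 : 0 ≤ M := (abs_nonneg _).trans (hM x hx t ht)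
  have := abs_le_mul_of_deriv_le (h := fun y => φ y t) (C := M * |x|)
    (fun y => (hφ.hasDerivAt_dX y t).differentiableAt) (h0 t)
    (fun y hy => (hA y ⟨hx.1.trans hy.1, hy.2⟩ t ht).trans
      (mul_le_mul_of_nonneg_left (by rw [abs_of_nonpos hy.2, abs_of_nonpos hx.2]; linarith [hy.1])
        hM0)) hx.2
  rwa [mul_assoc, ← pow_two, sq_abs] at this

open Filter in
/-- Cutting off a test function that vanishes to second order at `x = 0`. -/
theorem tendsto_fluxPairing_cutoff {a c T : ℝ} (ha : 0 < a) {f : ℝ → ℝ → ℝ}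
    {u₀ v₀ pl : ℝ → ℝ} {u φ : ℝ → ℝ → ℝ} (hd : IntegrableData T (-a) 0 f u₀ v₀ pl 0 u)
    (hφ : SmoothST φ) (h0 : ∀ t, φ 0 t = 0) (h1 : ∀ t, dX φ 0 t = 0) {θ : ℝ → ℝ} {K : ℝ}
    (hθ : ContDiff ℝ ∞ θ) (hθ1 : ∀ y ≤ -1, θ y = 1) (hθd : ∀ y < -1, deriv θ y = 0)
    (hθdd : ∀ y < -1, deriv (deriv θ) y = 0) (hθb : ∀ y, |θ y| ≤ 1)
    (hK1 : ∀ y ≤ 0, |y * deriv θ y| ≤ K) (hK2 : ∀ y ≤ 0, |y ^ 2 * deriv (deriv θ) y| ≤ K) :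
    Tendsto (fun n : ℕ => fluxPairing c T (-a) 0 f u₀ v₀ pl 0 u
      (fun x t => θ (n * x) * φ x t)) atTop (nhds (fluxPairing c T (-a) 0 f u₀ v₀ pl 0 u φ)) := by
  have hs : ∀ n : ℕ, ContDiff ℝ ∞ fun x : ℝ => θ (n * x) := fun n => hθ.comp (by fun_prop)
  have hd1 : ∀ n : ℕ, deriv (fun x : ℝ => θ (n * x)) = fun x => n * deriv θ (n * x) := fun n => by
    ext x
    simpa using deriv_comp_mul_left (n : ℝ) θ x
  have hd2 : ∀ n : ℕ, deriv (deriv (fun x : ℝ => θ (n * x))) =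
      fun x => n ^ 2 * deriv (deriv θ) (n * x) := fun n => by
    rw [hd1]
    ext x
    have := deriv_comp_mul_left (n : ℝ) (deriv θ) x
    rw [deriv_const_mul_field, this, smul_eq_mul]
    ring
  have hlarge : ∀ x < 0, ∀ᶠ n : ℕ in atTop, (n : ℝ) * x < -1 := fun x hx => by
    have := (tendsto_natCast_atTop_atTop (R := ℝ)).atTop_mul_const_of_neg hx
    exact this.eventually (eventually_lt_atBot _)
  have hW : ∀ (n : ℕ) x t, waveOp c (fun x t => θ (n * x) * φ x t) x t =
      θ (n * x) * waveOp c φ x t - c ^ 2 * (2 * (n * deriv θ (n * x) * dX φ x t) +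
        n ^ 2 * deriv (deriv θ) (n * x) * φ x t) := fun n x t => by
    rw [waveOp_smul_space c (hs n) hφ, hd2, hd1]
  simp only [fluxPairing_eq]
  refine Tendsto.add (Tendsto.add ?_ ?_) (Tendsto.const_mul _ ?_)
  · obtain ⟨C, hC⟩ := exists_bound_on_rectangle (hφ.continuous_waveOp c) (-a) 0 T
    obtain ⟨C', hC'⟩ := exists_bound_on_rectangle hφ.continuous (-a) 0 T
    obtain ⟨M, hM⟩ := flat_bounds (a := a) (T := T) hφ h0 h1
    have hmem : ∀ᵐ z : ℝ × ℝ ∂volume.restrict (Ioo (-a) 0 ×ˢ Ioo 0 T),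
        z ∈ Ioo (-a) 0 ×ˢ Ioo 0 T := ae_restrict_mem (measurableSet_Ioo.prod measurableSet_Ioo)
    refine tendsto_integral_of_dominated_convergence
      (fun z => ‖u z.1 z.2‖ * (C + c ^ 2 * (2 * (M * K) + M * K)) + ‖f z.1 z.2‖ * C')
      (fun n => (hd.integrableOn_interior (hφ.smul_space (hs n)) c).1)
      ((hd.2.2.2.1.norm.mul_const _).add (hd.1.norm.mul_const _)) (fun n => ?_) ?_
    · filter_upwards [hmem] with z hz
      obtain ⟨x, t⟩ := z
      have hx : x ∈ Icc (-a) 0 := Ioo_subset_Icc_self hz.1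
      have ht : t ∈ Icc 0 T := Ioo_subset_Icc_self hz.2
      obtain ⟨hM1, hM2⟩ := hM x hx t ht
      have hx0 : x < 0 := hz.1.2
      have hM0 : 0 ≤ M := nonneg_of_mul_nonneg_left ((abs_nonneg _).trans hM1) (abs_pos.2 hx0.ne)
      have hnx : (n : ℝ) * x ≤ 0 := mul_nonpos_of_nonneg_of_nonpos (Nat.cast_nonneg _) hx0.le
      have b1 : |θ (n * x) * waveOp c φ x t| ≤ C := by
        rw [abs_mul]
        exact (mul_le_of_le_one_left (abs_nonneg _) (hθb _)).trans (hC x hx t ht)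
      -- `|dX φ| ≤ M |x|` turns `n θ'(n x)` into `(n x) θ'(n x)`, which is bounded independently of
      -- `n`; the next bound does the same with `x²`.
      have b2 : |n * deriv θ (n * x) * dX φ x t| ≤ M * K := by
        rw [abs_mul]
        calc |n * deriv θ (n * x)| * |dX φ x t| ≤ |n * deriv θ (n * x)| * (M * |x|) :=
              mul_le_mul_of_nonneg_left hM1 (abs_nonneg _)
          _ = M * |n * x * deriv θ (n * x)| := by simp only [abs_mul]; ring
          _ ≤ M * K := mul_le_mul_of_nonneg_left (hK1 _ hnx) hM0
      have b3 : |n ^ 2 * deriv (deriv θ) (n * x) * φ x t| ≤ M * K := by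
        rw [abs_mul]
        calc |n ^ 2 * deriv (deriv θ) (n * x)| * |φ x t| ≤
              |n ^ 2 * deriv (deriv θ) (n * x)| * (M * x ^ 2) :=
              mul_le_mul_of_nonneg_left hM2 (abs_nonneg _)
          _ = M * |(n * x) ^ 2 * deriv (deriv θ) (n * x)| := by
              rw [mul_pow, abs_mul, abs_mul, abs_mul, abs_of_nonneg (sq_nonneg x)]; ring
          _ ≤ M * K := mul_le_mul_of_nonneg_left (hK2 _ hnx) hM0
      have b4 : |waveOp c (fun x t => θ (n * x) * φ x t) x t| ≤
          C + c ^ 2 * (2 * (M * K) + M * K) := by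
        rw [hW]
        refine (abs_sub _ _).trans (add_le_add b1 ?_)
        rw [abs_mul, abs_of_nonneg (sq_nonneg c)]
        refine mul_le_mul_of_nonneg_left ((abs_add_le _ _).trans (add_le_add ?_ b3)) (sq_nonneg c)
        rw [abs_mul, abs_two]
        exact mul_le_mul_of_nonneg_left b2 zero_le_two
      have b5 : |θ (n * x) * φ x t| ≤ C' := by
        rw [abs_mul]
        exact (mul_le_of_le_one_left (abs_nonneg _) (hθb _)).trans (hC' x hx t ht)
      refine (norm_sub_le _ _).trans (add_le_add ?_ ?_)
      · rw [norm_mul]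
        exact mul_le_mul_of_nonneg_left b4 (norm_nonneg _)
      · rw [norm_mul]
        exact mul_le_mul_of_nonneg_left b5 (norm_nonneg _)
    · filter_upwards [hmem] with z hz
      refine tendsto_const_nhds.congr' ?_
      filter_upwards [hlarge z.1 hz.1.2] with n hn
      rw [hW, hθ1 _ hn.le, hθd _ hn, hθdd _ hn]
      ring
  · refine tendsto_integral_of_dominated_convergence
      (fun x => ‖u₀ x * dT φ x 0 - v₀ x * φ x 0‖)
      (fun n => (hd.integrableOn_initial (hφ.smul_space (hs n))).1)
      (hd.integrableOn_initial hφ).norm (fun n => ?_) ?_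
    · refine Eventually.of_forall fun x => ?_
      rw [dT_smul_space _ hφ]
      have e : u₀ x * (θ (n * x) * dT φ x 0) - v₀ x * (θ (n * x) * φ x 0) =
        θ (n * x) * (u₀ x * dT φ x 0 - v₀ x * φ x 0) := by ring
      rw [e, norm_mul]
      exact mul_le_of_le_one_left (norm_nonneg _) (hθb _)
    · filter_upwards [ae_restrict_mem measurableSet_Ioo] with x hx
      refine tendsto_const_nhds.congr' ?_
      filter_upwards [hlarge x hx.2] with n hn
      simp only [dT_smul_space _ hφ, hθ1 _ hn.le, one_mul]
  · refine tendsto_const_nhds.congr' ?_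
    filter_upwards [hlarge (-a) (by linarith)] with n hn
    congr 1; ext t
    simp only [dX_smul_space (hs n) hφ, hd1, hθ1 _ hn.le, hθd _ hn, Pi.zero_apply]
    ring

/-- A weak solution on `(-a, b)` does not see the interface when it is tested on `(-a, 0)` with a
function that vanishes there to second order. -/
theorem pairing_eq_zero_of_flat {a b c T : ℝ} (ha : 0 < a) (hb : 0 < b)
    {f : ℝ → ℝ → ℝ} {u₀ v₀ pl pr : ℝ → ℝ} {u φ : ℝ → ℝ → ℝ}
    (hd : IntegrableData T (-a) b f u₀ v₀ pl pr u)
    (hu : IsDirichletSolution c T (-a) b f u₀ v₀ pl pr u)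
    (hφ : IsTestOn T (-a) 0 φ) (hφa : ∀ t, φ (-a) t = 0) (h0 : ∀ t, φ 0 t = 0)
    (h1 : ∀ t, dX φ 0 t = 0) :
    fluxPairing c T (-a) 0 f u₀ v₀ pl 0 u φ = 0 := by
  obtain ⟨θ, K, hθ, hθ1, hθ0, hθd, hθdd, hθb, hK1, hK2⟩ := exists_smooth_step
  obtain ⟨hd1, -⟩ := hd.split (p := 0) ha hb integrableOn_zero
  refine tendsto_nhds_unique_of_eventuallyEq (tendsto_fluxPairing_cutoff (c := c) ha hd1 hφ.1 h0 h1
    hθ hθ1 hθd hθdd hθb hK1 hK2) (tendsto_const_nhds (x := (0 : ℝ))) ?_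
  filter_upwards [Filter.eventually_gt_atTop 0] with n hn
  have hn' : (0 : ℝ) < n := Nat.cast_pos.2 hn
  -- The cutoff vanishes to the right of `-1/(2n)`, so the product is a test function on all of
  -- `(-a, b)` and contributes nothing on `(0, b)`.
  have hz : ∀ x > -(1 / (2 * n) : ℝ), ∀ t, θ (n * x) * φ x t = 0 := fun x hx t => by
    rw [hθ0, zero_mul]
    have := mul_lt_mul_of_pos_left hx hn'
    have e : (n : ℝ) * -(1 / (2 * n)) = -1 / 2 := by field_simp
    linarith
  have hs : SmoothST fun x t => θ (n * x) * φ x t :=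
    hφ.1.smul_space (hθ.comp (by fun_prop : ContDiff ℝ ∞ fun x : ℝ => (n : ℝ) * x))
  have ht : IsTestOn T (-a) b fun x t => θ (n * x) * φ x t := by
    obtain ⟨-, ε, hε, τ, hτ, hv⟩ := hφ
    refine ⟨hs, ε, hε, τ, hτ, fun x hx t ht => ?_⟩
    by_cases hx0 : x < 0 + ε
    · simp [hv x ⟨hx.1, hx0⟩ t ht]
    · exact hz x (by have : (0 : ℝ) < 1 / (2 * n) := by positivity
                     linarith) t
  have e1 := hu.pairing_eq_zero (by linarith) ht (fun t => by simp [hφa])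
    (fun t => hz b (by have : (0 : ℝ) < 1 / (2 * n) := by positivity
                       linarith) t)
  rw [fluxPairing_split ha hb hd (p := 0) integrableOn_zero hs,
    fluxPairing_congr (l := 0) (ψ := fun _ _ => 0) hb.le (ε := 1 / (2 * n)) (by positivity)
      (fun x hx t => hz x (by linarith [hx.1]) t), fluxPairing_zero, add_zero] at e1
  exact e1

/-! ### Functionals with an integrable density -/

section Representable

variable {Z : Type*} [MeasurableSpace Z] {μ : Measure Z}

/-- The image of a finite measure with density `m⁺` has an integrable density, if the map does not
charge null sets. -/
theorem exists_density_of_map_pos {m : Z → ℝ} {s : Z → ℝ} (hm : Integrable m μ)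
    (hs : Measurable s) (hac : μ.map s ≪ volume) :
    ∃ P : ℝ → ℝ, Integrable P ∧ ∀ η : ℝ → ℝ, Measurable η →
      ∫ z, max (m z) 0 * η (s z) ∂μ = ∫ t, P t * η t := by
  set ρ := μ.withDensity fun z => ENNReal.ofReal (m z) with hρ
  have hfin : IsFiniteMeasure ρ := isFiniteMeasure_withDensity_ofReal hm.2
  have hacρ : ρ.map s ≪ volume := ((withDensity_absolutelyContinuous μ _).map hs).trans hac
  have hfin' : IsFiniteMeasure (ρ.map s) := Measure.isFiniteMeasure_map ρ s
  refine ⟨fun t => ((ρ.map s).rnDeriv volume t).toReal, Measure.integrable_toReal_rnDeriv,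
    fun η hη => ?_⟩
  have h1 := integral_rnDeriv_smul hacρ (f := η)
  simp only [smul_eq_mul] at h1
  rw [h1, integral_map hs.aemeasurable hη.aestronglyMeasurable, hρ,
    integral_withDensity_eq_integral_toReal_smul₀ hm.1.aemeasurable.ennreal_ofReal
      (Filter.Eventually.of_forall fun _ => ENNReal.ofReal_lt_top)]
  simp [ENNReal.toReal_ofReal']

/-- A linear functional of `R` that is given by an integrable density tested against `R'`. -/
def Representable (T : ℝ) (F : (ℝ → ℝ) → ℝ) : Prop :=
  ∃ P : ℝ → ℝ, IntegrableOn P (Ioo 0 T) ∧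
    ∀ R, IsTimeTest T R → F R = ∫ t in Ioo 0 T, P t * deriv R t

variable {T : ℝ} {F G : (ℝ → ℝ) → ℝ}

theorem IsTimeTest.deriv {R : ℝ → ℝ} (hR : IsTimeTest T R) : IsTimeTest T (deriv R) := by
  obtain ⟨hs, τ, hτ, h0⟩ := hR
  refine ⟨contDiff_deriv hs, (τ + T) / 2, by linarith, fun t ht => ?_⟩
  have : R =ᶠ[nhds t] fun _ => 0 := by
    filter_upwards [isOpen_Ioi.mem_nhds (show τ < t by linarith)] with y hy using h0 y (le_of_lt hy)
  rw [this.deriv_eq, deriv_const]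

theorem IsTimeTest.eq_zero {R : ℝ → ℝ} (hR : IsTimeTest T R) {t : ℝ} (ht : T ≤ t) : R t = 0 := by
  obtain ⟨-, τ, hτ, h0⟩ := hR
  exact h0 t (hτ.le.trans ht)

theorem Representable.add (hF : Representable T F) (hG : Representable T G) :
    Representable T (fun R => F R + G R) := by
  obtain ⟨P, hP, h⟩ := hF
  obtain ⟨Q, hQ, h'⟩ := hG
  refine ⟨fun t => P t + Q t, hP.add hQ, fun R hR => ?_⟩
  have hc := hR.deriv.1.continuous
  simp only [add_mul]
  rw [h R hR, h' R hR, integral_add (integrableOn_mul_continuous hP hc)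
    (integrableOn_mul_continuous hQ hc)]

theorem Representable.const_mul (hF : Representable T F) (k : ℝ) :
    Representable T (fun R => k * F R) := by
  obtain ⟨P, hP, h⟩ := hF
  refine ⟨fun t => k * P t, hP.const_mul k, fun R hR => ?_⟩
  simp only [mul_assoc]
  rw [h R hR, integral_const_mul]

theorem Representable.congr (hF : Representable T F) (h : ∀ R, IsTimeTest T R → G R = F R) :
    Representable T G := by
  obtain ⟨P, hP, h'⟩ := hF
  exact ⟨P, hP, fun R hR => (h R hR).trans (h' R hR)⟩

/-- Push the signed measure `m μ` forward by `s`, splitting `m` into positive and negative parts.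
Positivity of `s` and the vanishing of `R'` after `T` confine everything to `(0, T)`. -/
theorem representable_deriv {m s : Z → ℝ} (hm : Integrable m μ)
    (hs : Measurable s) (hac : μ.map s ≪ volume) (hpos : ∀ᵐ z ∂μ, 0 < s z) :
    Representable T (fun R => ∫ z, m z * deriv R (s z) ∂μ) := by
  obtain ⟨P, hP, h1⟩ := exists_density_of_map_pos hm hs hac
  obtain ⟨Q, hQ, h2⟩ := exists_density_of_map_pos hm.neg hs hac
  refine ⟨fun t => P t - Q t, (hP.sub hQ).integrableOn, fun R hR => ?_⟩
  have hc : Continuous (deriv R) := hR.deriv.1.continuous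
  set η : ℝ → ℝ := (Ioo 0 T).indicator (deriv R) with hη
  have hηm : Measurable η := hc.measurable.indicator measurableSet_Ioo
  obtain ⟨C, hC⟩ := isCompact_Icc.exists_bound_of_continuousOn (s := Icc 0 T) hc.continuousOn
  have hηb : ∀ t, ‖η t‖ ≤ max C 0 := fun t => by
    by_cases ht : t ∈ Ioo 0 T
    · rw [hη, indicator_of_mem ht]
      exact (hC t (Ioo_subset_Icc_self ht)).trans (le_max_left _ _)
    · rw [hη, indicator_of_notMem ht, norm_zero]
      exact le_max_right _ _
  have e1 : ∫ z, m z * deriv R (s z) ∂μ = ∫ z, m z * η (s z) ∂μ := by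
    refine integral_congr_ae ?_
    filter_upwards [hpos] with z hz
    by_cases hT : s z < T
    · rw [hη, indicator_of_mem (show s z ∈ Ioo 0 T from ⟨hz, hT⟩)]
    · rw [hη, indicator_of_notMem (fun h => hT h.2), hR.deriv.eq_zero (not_lt.1 hT)]
  have b1 : ∀ {h : Z → ℝ}, Integrable h μ → Integrable (fun z => h z * η (s z)) μ := fun hh =>
    hh.mul_bdd (c := max C 0) (hηm.comp hs).aestronglyMeasurable
      (Filter.Eventually.of_forall fun z => hηb _)
  have b2 : ∀ {h : ℝ → ℝ}, Integrable h → Integrable (fun t => h t * η t) := fun hh =>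
    hh.mul_bdd (c := max C 0) hηm.aestronglyMeasurable (Filter.Eventually.of_forall fun z => hηb _)
  have e2 : ∫ z, m z * η (s z) ∂μ =
      (∫ z, max (m z) 0 * η (s z) ∂μ) - ∫ z, max (-m z) 0 * η (s z) ∂μ := by
    rw [← integral_sub (b1 hm.pos_part) (b1 hm.neg_part)]
    congr 1; ext z
    rw [← sub_mul]
    congr 1
    rcases le_total (m z) 0 with h | h
    · rw [max_eq_right h, max_eq_left (by linarith)]; ring
    · rw [max_eq_left h, max_eq_right (by linarith)]; ring
  have e3 := h2 η hηm
  simp only [Pi.neg_apply] at e3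
  beta_reduce
  rw [e1, e2, h1 η hηm, e3, ← integral_sub (b2 hP) (b2 hQ), ← integral_indicator measurableSet_Ioo]
  congr 1; ext t
  by_cases ht : t ∈ Ioo 0 T
  · rw [hη, indicator_of_mem ht, indicator_of_mem ht, sub_mul]
  · rw [hη, indicator_of_notMem ht, indicator_of_notMem ht]; ring

/-- Write `R(s) = -∫_s^T R'` and exchange the integrals. No absolute continuity of the image measure
is needed. -/
theorem representable_primitive [SFinite μ] {m s : Z → ℝ} (hm : Integrable m μ)
    (hs : Measurable s) (hpos : ∀ᵐ z ∂μ, 0 < s z) :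
    Representable T (fun R => ∫ z, m z * R (s z) ∂μ) := by
  have hset : MeasurableSet {q : Z × ℝ | s q.1 < q.2} :=
    measurableSet_lt (hs.comp measurable_fst) measurable_snd
  have hk : Integrable (fun q : Z × ℝ => {q : Z × ℝ | s q.1 < q.2}.indicator (fun q => m q.1) q)
      (μ.prod (volume.restrict (Ioo 0 T))) :=
    (hm.comp_fst _).indicator hset
  refine ⟨fun t => -∫ z, {q : Z × ℝ | s q.1 < q.2}.indicator (fun q => m q.1) (z, t) ∂μ,
    hk.integral_prod_right.neg, fun R hR => ?_⟩
  have hc : Continuous (deriv R) := hR.deriv.1.continuous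
  obtain ⟨C, hC⟩ := isCompact_Icc.exists_bound_of_continuousOn (s := Icc 0 T) hc.continuousOn
  have hk2 : Integrable (fun q : Z × ℝ =>
      {q : Z × ℝ | s q.1 < q.2}.indicator (fun q => m q.1) q * -deriv R q.2)
      (μ.prod (volume.restrict (Ioo 0 T))) := by
    refine hk.mul_bdd (c := C)
      (hc.neg.measurable.comp measurable_snd).aestronglyMeasurable ?_
    filter_upwards [Measure.quasiMeasurePreserving_snd.ae
      (ae_restrict_mem (μ := volume) (measurableSet_Ioo (a := 0) (b := T)))] with q hq
    rw [norm_neg]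
    exact hC _ (Ioo_subset_Icc_self hq)
  have hsl : ∀ᵐ z ∂μ, m z * R (s z) = ∫ t in Ioo 0 T,
      {q : Z × ℝ | s q.1 < q.2}.indicator (fun q => m q.1) (z, t) * -deriv R t := by
    filter_upwards [hpos] with z hz
    have e1 : ∀ t, {q : Z × ℝ | s q.1 < q.2}.indicator (fun q => m q.1) (z, t) * -deriv R t =
        m z * (Ioi (s z)).indicator (fun t => -deriv R t) t := fun t => by
      by_cases h : s z < t
      · rw [indicator_of_mem (show (z, t) ∈ {q : Z × ℝ | s q.1 < q.2} from h),
          indicator_of_mem (show t ∈ Ioi (s z) from h)]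
      · rw [indicator_of_notMem (show (z, t) ∉ {q : Z × ℝ | s q.1 < q.2} from h),
          indicator_of_notMem (show t ∉ Ioi (s z) from h)]; ring
    simp only [e1]
    rw [integral_const_mul]
    congr 1
    rw [setIntegral_indicator measurableSet_Ioi]
    have e2 : Ioo 0 T ∩ Ioi (s z) = Ioo (s z) T := by
      ext t
      simp only [mem_inter_iff, mem_Ioo, mem_Ioi]
      exact ⟨fun h => ⟨h.2, h.1.2⟩, fun h => ⟨⟨hz.trans h.1, h.2⟩, h.1⟩⟩
    rw [e2]
    rcases lt_or_ge (s z) T with h | h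
    · rw [integral_neg, ← integral_Ioc_eq_integral_Ioo, ← intervalIntegral.integral_of_le h.le,
        intervalIntegral.integral_eq_sub_of_hasDerivAt
          (fun t _ => hasDerivAt_of_contDiff hR.1 t) (hc.intervalIntegrable _ _),
        hR.eq_zero le_rfl]
      ring
    · rw [Ioo_eq_empty (not_lt.2 h), setIntegral_empty, hR.eq_zero h]
  beta_reduce
  rw [integral_congr_ae hsl, integral_integral_swap hk2]
  congr 1; ext t
  rw [integral_mul_const]
  ring

end Representable

/-- For fixed `x` the map is a translation in `t`, so every slice of the preimage of a null set is
null. The `+ 0` matches `wave R σ 0`. -/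
theorem map_restrict_shear_absolutelyContinuous (S : Set (ℝ × ℝ)) (σ : ℝ) :
    (volume.restrict S).map (fun z : ℝ × ℝ => z.2 + σ * z.1 + 0) ≪ (volume : Measure ℝ) := by
  have hs : Measurable fun z : ℝ × ℝ => z.2 + σ * z.1 + 0 := by fun_prop
  refine Measure.AbsolutelyContinuous.mk fun N hN h0 => ?_
  rw [Measure.map_apply hs hN]
  refine le_antisymm ((Measure.restrict_apply_le _ _).trans_eq ?_) bot_le
  rw [Measure.volume_eq_prod, Measure.measure_prod_null (hs hN)]
  refine Filter.Eventually.of_forall fun x => ?_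
  have : Prod.mk x ⁻¹' ((fun z : ℝ × ℝ => z.2 + σ * z.1 + 0) ⁻¹' N) =
      (fun t => t + (σ * x + 0)) ⁻¹' N := by
    ext t
    simp
  beta_reduce
  rw [this]
  simpa only [measure_preimage_add_right, Pi.zero_apply] using h0

theorem map_restrict_mul_absolutelyContinuous (S : Set ℝ) {σ : ℝ} (hσ : σ ≠ 0) :
    (volume.restrict S).map (fun x : ℝ => 0 + σ * x + 0) ≪ (volume : Measure ℝ) := by
  have hs : Measurable fun x : ℝ => 0 + σ * x + 0 := by fun_prop
  refine Measure.AbsolutelyContinuous.mk fun N hN h0 => ?_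
  rw [Measure.map_apply hs hN]
  refine le_antisymm ((Measure.restrict_apply_le _ _).trans_eq ?_) bot_le
  simp only [zero_add, add_zero]
  rw [Real.volume_preimage_mul_left hσ, h0, mul_zero]

/-- The pairing with a localized wave that travels away from the interface. -/
theorem representable_fluxPairing {c T l r σ : ℝ} (hσ : c ^ 2 * σ ^ 2 = 1)
    {f : ℝ → ℝ → ℝ} {u₀ v₀ pl pr κ : ℝ → ℝ} {u : ℝ → ℝ → ℝ}
    (hd : IntegrableData T l r f u₀ v₀ pl pr u) (hκ : ContDiff ℝ ∞ κ)
    (hpos : ∀ x ∈ Ioo l r, 0 < σ * x) (hl : pl = 0 ∨ (κ l = 0 ∧ deriv κ l = 0))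
    (hr : pr = 0 ∨ (κ r = 0 ∧ deriv κ r = 0)) :
    Representable T (fun R => fluxPairing c T l r f u₀ v₀ pl pr u
      (fun x t => κ x * wave R σ 0 x t)) := by
  have hσ0 : σ ≠ 0 := by rintro rfl; simp at hσ
  have c0 := hκ.continuous
  have c1 := (contDiff_deriv hκ).continuous
  have c2 := (contDiff_deriv (contDiff_deriv hκ)).continuous
  have hu := hd.2.2.2.1
  have pos1 : ∀ᵐ z : ℝ × ℝ ∂volume.restrict (Ioo l r ×ˢ Ioo 0 T), 0 < z.2 + σ * z.1 + 0 := by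
    filter_upwards [ae_restrict_mem (measurableSet_Ioo.prod measurableSet_Ioo)] with z hz
    linarith [hpos z.1 hz.1, hz.2.1]
  have pos2 : ∀ᵐ x ∂volume.restrict (Ioo l r), 0 < 0 + σ * x + 0 := by
    filter_upwards [ae_restrict_mem measurableSet_Ioo] with x hx
    linarith [hpos x hx]
  have m1 : IntegrableOn (fun z : ℝ × ℝ => u z.1 z.2 * (-(2 * c ^ 2 * σ) * deriv κ z.1))
    (Ioo l r ×ˢ Ioo 0 T) := integrableOn_mul_continuous_prod hu (by fun_prop)
  have m2 : IntegrableOn (fun z : ℝ × ℝ => u z.1 z.2 * (-(c ^ 2) * deriv (deriv κ) z.1)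
    - f z.1 z.2 * κ z.1) (Ioo l r ×ˢ Ioo 0 T) :=
    (integrableOn_mul_continuous_prod hu (by fun_prop)).sub
      (integrableOn_mul_continuous_prod hd.1 (by fun_prop))
  have m3 : IntegrableOn (fun x => u₀ x * κ x) (Ioo l r) := integrableOn_mul_continuous hd.2.1 c0
  have m4 : IntegrableOn (fun x => v₀ x * κ x) (Ioo l r) :=
    integrableOn_mul_continuous hd.2.2.1 c0
  have ms : Measurable fun z : ℝ × ℝ => z.2 + σ * z.1 + 0 := by fun_prop
  have ms' : Measurable fun x : ℝ => 0 + σ * x + 0 := by fun_prop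
  -- The wave operator annihilates the wave, so applied to `κ` times the wave it leaves only terms
  -- with `R'` and `R`; the initial data contribute one of each. An `R''` would have no such
  -- density.
  refine ((((representable_deriv m1 ms (map_restrict_shear_absolutelyContinuous _ σ) pos1).add
    (representable_primitive m2 ms pos1)).add
    (representable_deriv m3 ms' (map_restrict_mul_absolutelyContinuous _ hσ0) pos2)).add
    ((representable_primitive m4 ms' pos2).const_mul (-1))).congr fun R hR => ?_
  have hw : SmoothST (wave R σ 0) := smoothST_wave hR.1 σ 0
  have k0 : Continuous R := hR.1.continuous
  have k1 : Continuous (deriv R) := hR.deriv.1.continuous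
  have hb : (∫ t in Ioo 0 T, (pr t * dX (fun x t => κ x * wave R σ 0 x t) r t -
      pl t * dX (fun x t => κ x * wave R σ 0 x t) l t)) = 0 := by
    refine integral_eq_zero_of_ae (Filter.Eventually.of_forall fun t => ?_)
    rw [dX_smul_space hκ hw]
    rcases hl with rfl | ⟨h1, h2⟩ <;> rcases hr with rfl | ⟨h3, h4⟩ <;> simp [*]
  rw [fluxPairing_eq, hb, mul_zero, add_zero, neg_one_mul, ← sub_eq_add_neg, add_sub_assoc]
  congr 1
  · rw [← integral_add (integrableOn_mul_continuous_prod m1 (by fun_prop))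
      (integrableOn_mul_continuous_prod m2 (by fun_prop))]
    congr 1; ext z
    rw [waveOp_smul_space c hκ hw, waveOp_wave hσ hR.1, dX_wave hR.1]
    simp only [wave]
    ring
  · rw [← integral_sub (integrableOn_mul_continuous m3 (by fun_prop))
      (integrableOn_mul_continuous m4 (by fun_prop))]
    congr 1; ext x
    rw [dT_smul_space _ hw, dT_wave hR.1]
    simp only [wave]
    ring

/-! ### Existence of the interface trace -/

theorem IsTestOn.smul_space {T l r : ℝ} {χ : ℝ → ℝ} {φ : ℝ → ℝ → ℝ} (hχ : ContDiff ℝ ∞ χ)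
    (h : IsTestOn T l r φ) : IsTestOn T l r (fun x t => χ x * φ x t) := by
  obtain ⟨hs, ε, hε, τ, hτ, h0⟩ := h
  exact ⟨hs.smul_space hχ, ε, hε, τ, hτ, fun x hx t ht => by simp [h0 x hx t ht]⟩

theorem IsTestFunction.isTestOn {T : ℝ} {φ : ℝ → ℝ → ℝ} (h : IsTestFunction T φ) (l r : ℝ) :
    IsTestOn T l r φ := by
  obtain ⟨hs, τ, hτ, h0⟩ := h
  exact ⟨hs, 1, one_pos, τ, hτ, fun x _ t ht => h0 x t ht⟩

theorem IsTestOn.isTimeTest_dX {T l r x : ℝ} {φ : ℝ → ℝ → ℝ} (h : IsTestOn T l r φ)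
    (hx : x ∈ Icc l r) : IsTimeTest T (dX φ x) := by
  obtain ⟨hs, ε, hε, τ, hτ, h0⟩ := h
  have : ContDiff ℝ ∞ (fun s : ℝ => (x, s)) := by fun_prop
  refine ⟨ContDiff.comp (g := fun z : ℝ × ℝ => dX φ z.1 z.2) hs.dX this, τ, hτ, fun t ht => ?_⟩
  have : (fun y => φ y t) =ᶠ[nhds x] fun _ => 0 := by
    filter_upwards [isOpen_Ioo.mem_nhds (show x ∈ Ioo (l - ε) (r + ε) from
      ⟨by linarith [hx.1], by linarith [hx.2]⟩)] with y hy using h0 y hy t ht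
  change deriv (fun y => φ y t) x = 0
  rw [this.deriv_eq, deriv_const]

/-- There is an integrable function that reproduces the pairings on `(-a, 0)` with the test
functions that vanish at both ends. -/
theorem exists_density_of_pairing {a b c T : ℝ} (ha : 0 < a) (hb : 0 < b) (hc : 0 < c)
    {f : ℝ → ℝ → ℝ} {u₀ v₀ pl pr : ℝ → ℝ} {u : ℝ → ℝ → ℝ}
    (hd : IntegrableData T (-a) b f u₀ v₀ pl pr u)
    (hu : IsDirichletSolution c T (-a) b f u₀ v₀ pl pr u) :
    ∃ p, IntegrableOn p (Ioo 0 T) ∧ ∀ φ, IsTestOn T (-a) 0 φ → (∀ t, φ (-a) t = 0) →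
      (∀ t, φ 0 t = 0) → fluxPairing c T (-a) 0 f u₀ v₀ pl 0 u φ =
        -(c ^ 2 * ∫ t in Ioo 0 T, p t * dX φ 0 t) := by
  have hm : 0 < min a b := lt_min ha hb
  obtain ⟨κ, hκ, hκ1, hκ0⟩ := exists_plateau 0 (r₁ := min a b / 4) (r₂ := min a b / 2)
    (by linarith) (by linarith)
  have hfar : ∀ x, min a b ≤ |x| → κ x = 0 ∧ deriv κ x = 0 := fun x hx => by
    have hev : κ =ᶠ[nhds x] fun _ => 0 := by
      have ho : IsOpen {y : ℝ | min a b / 2 < |y|} := isOpen_lt continuous_const continuous_abs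
      filter_upwards [ho.mem_nhds (show min a b / 2 < |x| by linarith)] with y hy
      exact hκ0 y (by rw [sub_zero]; exact le_of_lt hy)
    exact ⟨hev.eq_of_nhds, by rw [hev.deriv_eq, deriv_const]⟩
  obtain ⟨κa, κa'⟩ := hfar (-a) (by rw [abs_neg, abs_of_pos ha]; exact min_le_left _ _)
  obtain ⟨κb, κb'⟩ := hfar b (by rw [abs_of_pos hb]; exact min_le_right _ _)
  have κ00 : κ 0 = 1 := hκ1 0 (by simp; positivity)
  obtain ⟨hd1, hd2⟩ := hd.split (p := 0) ha hb integrableOn_zero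
  have hcσ : c ^ 2 * (1 / c) ^ 2 = 1 := by field_simp
  have hcσ' : c ^ 2 * (-(1 / c)) ^ 2 = 1 := by field_simp
  have hc1 : 0 < 1 / c := by positivity
  obtain ⟨P, hP, hrep⟩ := (representable_fluxPairing hcσ' hd1 hκ
    (fun x hx => by rw [neg_mul]; exact neg_pos.2 (mul_neg_of_pos_of_neg hc1 hx.2))
    (Or.inr ⟨κa, κa'⟩) (Or.inl rfl)).add (representable_fluxPairing hcσ hd2 hκ
    (fun x hx => mul_pos hc1 hx.1) (Or.inl rfl) (Or.inr ⟨κb, κb'⟩))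
  refine ⟨fun t => (1 / (2 * c)) * P t, hP.const_mul _, fun φ hφ hφa hφ0 => ?_⟩
  obtain ⟨ν, hν, dν⟩ := (hφ.isTimeTest_dX (x := 0) ⟨by linarith, le_rfl⟩).exists_primitive
  -- Chosen so that `-R'/c` is the slope of `φ`, the slope at `0` of both `κ (R(t - x/c) - R(t))`
  -- and `κ (R(t) - R(t + x/c))`.
  set R : ℝ → ℝ := fun t => -c * ν t with hR
  have hRt : IsTimeTest T R := hν.const_mul _
  have dR : ∀ t, deriv R t = -c * dX φ 0 t := fun t => by
    rw [← dν]
    exact ((hasDerivAt_of_contDiff hν.1 t).const_mul (-c)).deriv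
  have tm : IsTestOn T (-a) 0 (fun x t => κ x * wave R (-(1 / c)) 0 x t) :=
    (hRt.isTestOn_wave (by rw [neg_mul_neg, add_zero]; positivity) (by simp)).smul_space hκ
  have tp : IsTestOn T 0 b (fun x t => κ x * wave R (1 / c) 0 x t) :=
    (hRt.isTestOn_wave (by simp) (by rw [add_zero]; positivity)).smul_space hκ
  have t0 : ∀ l r, IsTestOn T l r (fun x t => κ x * R t) := fun l r => hRt.isTestOn_mul hκ
  have x0 : ∀ t, dX (fun x t => κ x * R t) 0 t = deriv κ 0 * R t := fun t =>
    ((hasDerivAt_of_contDiff hκ 0).mul_const (R t)).deriv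
  have xw : ∀ σ t, dX (fun x t => κ x * wave R σ 0 x t) 0 t =
      deriv κ 0 * R t + σ * deriv R t := fun σ t => by
    rw [dX_smul_space hκ (smoothST_wave hRt.1 σ 0), dX_wave hRt.1]
    simp [wave, κ00]
  set χ₁ : ℝ → ℝ → ℝ := fun x t => κ x * wave R (-(1 / c)) 0 x t - κ x * R t with hχ₁
  set χ₂ : ℝ → ℝ → ℝ := fun x t => κ x * R t - κ x * wave R (1 / c) 0 x t with hχ₂
  have tχ₁ : IsTestOn T (-a) 0 χ₁ := tm.sub (t0 _ _)
  have tχ₂ : IsTestOn T 0 b χ₂ := (t0 _ _).sub tp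
  have dχ₁ : ∀ t, dX χ₁ 0 t = dX φ 0 t := fun t => by
    rw [hχ₁, dX_sub tm.1 (t0 0 0).1]
    beta_reduce
    rw [x0, xw, dR]
    field_simp
    ring
  have dχ₂ : ∀ t, dX χ₂ 0 t = dX φ 0 t := fun t => by
    rw [hχ₂, dX_sub (t0 0 0).1 tp.1]
    beta_reduce
    rw [x0, xw, dR]
    field_simp
    ring
  -- `χ₂` becomes a test function on all of `(-a, b)`: the left pairing with `ψ` is then minus the
  -- right pairing with `χ₂`.
  obtain ⟨ψ, hψ, hψ0, ε, hε, hψe⟩ := tχ₂.exists_isTestFunction hb.le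
  have ψ00 : ∀ t, ψ 0 t = 0 := hψ0 0 fun t => by simp [hχ₂, wave]
  have ψa : ∀ t, ψ (-a) t = 0 := hψ0 _ fun t => by simp [hχ₂, κa]
  have ψb : ∀ t, ψ b t = 0 := hψ0 _ fun t => by simp [hχ₂, κb]
  have dψ : ∀ t, dX ψ 0 t = dX φ 0 t := fun t => by
    rw [← dχ₂ t]
    refine Filter.EventuallyEq.deriv_eq ?_
    filter_upwards [isOpen_Ioo.mem_nhds (show (0 : ℝ) ∈ Ioo (0 - ε) (b + ε) from
      ⟨by linarith, by linarith⟩)] with y hy using hψe y hy t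
  have hψt := hψ.isTestOn (-a) 0
  have e1 := pairing_eq_zero_of_flat ha hb hd hu (hφ.sub tχ₁) (fun t => by simp [hφa, hχ₁, κa])
    (fun t => by simp [hφ0, hχ₁, wave]) (fun t => by
      rw [dX_sub hφ.1 tχ₁.1]
      exact sub_eq_zero.2 (dχ₁ t).symm)
  have e2 := pairing_eq_zero_of_flat ha hb hd hu (hφ.sub hψt) (fun t => by simp [hφa, ψa])
    (fun t => by simp [hφ0, ψ00]) (fun t => by
      rw [dX_sub hφ.1 hψt.1]
      exact sub_eq_zero.2 (dψ t).symm)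
  have e3 := hu.pairing_eq_zero (by linarith) (hψ.isTestOn (-a) b) ψa ψb
  have e4 := hu.pairing_eq_zero (by linarith) (t0 (-a) b) (fun t => by simp [κa])
    (fun t => by simp [κb])
  rw [fluxPairing_split ha hb hd (p := 0) integrableOn_zero hψt.1,
    fluxPairing_congr (l := 0) hb.le hε hψe, fluxPairing_sub hd2 (t0 0 0).1 tp.1] at e3
  rw [fluxPairing_split ha hb hd (p := 0) integrableOn_zero (t0 0 0).1] at e4
  rw [fluxPairing_sub hd1 hφ.1 tχ₁.1, fluxPairing_sub hd1 tm.1 (t0 0 0).1] at e1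
  rw [fluxPairing_sub hd1 hφ.1 hψt.1] at e2
  have e5 := hrep R hRt
  have e6 : -(c ^ 2 * ∫ t in Ioo 0 T, (1 / (2 * c)) * P t * dX φ 0 t) =
      (1 / 2) * ∫ t in Ioo 0 T, P t * deriv R t := by
    rw [← neg_mul, ← integral_const_mul, ← integral_const_mul]
    congr 1; ext t
    rw [dR]
    field_simp
  -- The left pairing with `φ` equals that with `χ₁`, and also minus the right pairing with `χ₂`. In
  -- the sum of the two expressions the `κ R` parts add up to a pairing on `(-a, b)`, which is zero;
  -- this removes `R''` and leaves the two waves.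
  rw [e6, ← e5]
  linarith

/-- Weak solutions have an integrable trace at the interface. -/
theorem exists_isInterfaceTrace {a b c T : ℝ} (ha : 0 < a) (hb : 0 < b) (hc : 0 < c)
    {f : ℝ → ℝ → ℝ} {u₀ v₀ : ℝ → ℝ} {g u : ℝ → ℝ → ℝ}
    (hd : IntegrableData T (-a) b f u₀ v₀ (g (-a)) (g b) u)
    (hu : IsDirichletSolution c T (-a) b f u₀ v₀ (g (-a)) (g b) u) :
    ∃ p, IsInterfaceTrace a b c T f u₀ v₀ g u p := by
  obtain ⟨p, hp, hpair⟩ := exists_density_of_pairing ha hb hc hd hu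
  obtain ⟨hd0, -⟩ := hd.split (p := 0) ha hb integrableOn_zero
  obtain ⟨hd1, hd2⟩ := hd.split (p := p) ha hb hp
  have hleft : ∀ φ, IsTestOn T (-a) 0 φ → (∀ t, φ (-a) t = 0) → (∀ t, φ 0 t = 0) →
      fluxPairing c T (-a) 0 f u₀ v₀ (g (-a)) p u φ = 0 := fun φ h h1 h2 => by
    have e := fluxPairing_sub_data (c := c) hd1 hd0 h.1
    rw [hpair φ h h1 h2] at e
    simp only [sub_self, zero_mul, integral_zero, Pi.zero_apply, sub_zero, zero_add] at e
    linarith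
  refine ⟨p, ⟨hd1.2.2.2, fun φ h => hleft φ (h.isTestOn _ _)⟩, hd2.2.2.2, fun φ h h0 hb0 => ?_⟩
  -- The plateau covers `[-a/4, b + a/4]` and the support ends at `-a/2`, so the right test function
  -- extends to `(-a, b)`; its left part is already known to pair to zero.
  obtain ⟨χ, hχ, hχ1, hχ0⟩ := exists_plateau (b / 2) (r₁ := b / 2 + a / 4) (r₂ := b / 2 + a / 2)
    (by positivity) (by linarith)
  have ht : ∀ l r, IsTestOn T l r fun x t => χ x * φ x t := fun l r =>
    (h.isTestOn l r).smul_space hχ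
  have χa : χ (-a) = 0 := hχ0 _ (by rw [abs_of_neg (by linarith)]; linarith)
  have e1 := hu.pairing_eq_zero (by linarith) (ht _ _) (fun t => by simp [χa])
    (fun t => by simp [hb0])
  rw [fluxPairing_split ha hb hd hp (ht 0 0).1, hleft _ (ht _ _) (fun t => by simp [χa])
    (fun t => by simp [h0]), zero_add] at e1
  refine Eq.trans ?_ e1
  refine fluxPairing_congr hb.le (ε := a / 4) (by positivity) fun x hx t => ?_
  rw [hχ1 x, one_mul]
  rw [abs_le]
  exact ⟨by linarith [hx.1], by linarith [hx.2]⟩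

end NNWR

/-! ### Conclusion -/

theorem mainTheorem2 (a b c T : ℝ) (ha : 0 < a) (hb : 0 < b) (hab : a ≠ b) (hc : 0 < c)
    (hT : 0 < T) (f : ℝ → ℝ → ℝ) (u₀ v₀ : ℝ → ℝ) (g : ℝ → ℝ → ℝ)
    (hf : IntegrableOn (fun z : ℝ × ℝ => f z.1 z.2) (Ioo (-a) b ×ˢ Ioo 0 T))
    (hu₀ : IntegrableOn u₀ (Ioo (-a) b)) (hv₀ : IntegrableOn v₀ (Ioo (-a) b))
    (hga : IntegrableOn (g (-a)) (Ioo 0 T)) (hgb : IntegrableOn (g b) (Ioo 0 T))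
    (u : ℝ → ℝ → ℝ)
    (hu : NNWR.IsDirichletSolution c T (-a) b f u₀ v₀ (g (-a)) (g b) u)
    (w : ℕ → ℝ → ℝ) (u₁ u₂ ψ₁ ψ₂ : ℕ → ℝ → ℝ → ℝ)
    (hrun : NNWR.IsRun a b c T (1 / 4) f u₀ v₀ g w u₁ u₂ ψ₁ ψ₂)
    (k : ℕ) (hk : 1 ≤ k) (hTk : T / (k : ℝ) ≤ 4 * min (a / c) (b / c)) :
    (∃ p, NNWR.IsInterfaceTrace a b c T f u₀ v₀ g u p) ∧
    (∀ p, NNWR.IsInterfaceTrace a b c T f u₀ v₀ g u p →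
      ∀ n, k ≤ n → ∀ᵐ t ∂volume.restrict (Ioo 0 T), w n t = p t) ∧
    (∀ n, k + 1 ≤ n →
      (∀ᵐ z : ℝ × ℝ ∂volume.restrict (Ioo (-a) 0 ×ˢ Ioo 0 T), u₁ n z.1 z.2 = u z.1 z.2) ∧
      (∀ᵐ z : ℝ × ℝ ∂volume.restrict (Ioo 0 b ×ˢ Ioo 0 T), u₂ n z.1 z.2 = u z.1 z.2)) := by
  have hd : NNWR.IntegrableData T (-a) b f u₀ v₀ (g (-a)) (g b) u := ⟨hf, hu₀, hv₀, hu.1⟩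
  obtain ⟨p, hp⟩ := NNWR.exists_isInterfaceTrace ha hb hc hd hu
  have hconv : ∀ p, NNWR.IsInterfaceTrace a b c T f u₀ v₀ g u p →
      ∀ n, k ≤ n → ∀ᵐ t ∂volume.restrict (Ioo 0 T), w n t = p t := by
    intro p hp n hn
    have hk0 : (0 : ℝ) < k := by exact_mod_cast hk
    have hm : 0 < 4 * min (a / c) (b / c) := by positivity
    have hkn : (k : ℝ) ≤ n := by exact_mod_cast hn
    rw [div_le_iff₀ hk0] at hTk
    filter_upwards [NNWR.interface_error_zone ha hb hc hd hu hp hrun n,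
      ae_restrict_mem measurableSet_Ioo] with t ht htm
    exact sub_eq_zero.1 (ht (htm.2.trans_le (hTk.trans (by nlinarith))))
  refine ⟨⟨p, hp⟩, hconv, ?_⟩
  rintro (_ | n) hn
  · omega
  have hw := hconv p hp n (by omega)
  obtain ⟨hd1, hd2⟩ := hd.split (p := p) ha hb hp.1.1.2.2
  obtain ⟨h1, h2, -⟩ := hrun n
  have hrefl : ∀ h : ℝ → ℝ, ∀ᵐ t ∂volume.restrict (Ioo 0 T), h t = h t := fun h =>
    Filter.Eventually.of_forall fun _ => rfl
  have hw' : ∀ᵐ t ∂volume.restrict (Ioo 0 T), p t = w n t := by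
    filter_upwards [hw] with t ht using ht.symm
  constructor
  -- Iteration `n + 1` uses the interface value `w n`, which equals the trace already for `n ≥ k`;
  -- this accounts for the extra iteration.
  · filter_upwards [hp.1.unique hc (by linarith) hd1 h1 (hrefl _) hw'] with z hz using hz.symm
  · filter_upwards [hp.2.unique hc hb hd2 h2 hw' (hrefl _)] with z hz using hz.symm
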